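/- Let $q\in\{2,4\}$. Let $C_1$ be an $[n_1,k_1,d_1]_q$ linear code (exact minimum distance $d_1$), $\rho_1=n_1-k_1$, and let $C_2$ be an $[n_2,k_2,d_2]$ linear code over $\mathrm{GF}(q^{\rho_1})$, $\rho_2=n_2-k_2$. Let $\alpha$ be a primitive element of $\mathrm{GF}(q^{\rho_1})$, and let $\psi:\mathrm{GF}(q^{\rho_1})\to \mathrm{GF}(q)^{\rho_1}$ be the coordinate map in the basis $1,\alpha,\dots,\alpha^{\rho_1-1}$. For a matrix $H$ over $\mathrm{GF}(q^{\rho_1})$, $\psi(H)$ replaces each entry by the column of its coordinates; for a $\rho_1\times n$ matrix $H$ over $\mathrm{GF}(q)$, $\psi^{-1}(H)$ is the $1\times n$ matrix over $\mathrm{GF}(q^{\rho_1})$ obtained by applying $\psi^{-1}$ to each column. Let $H_1$, $H_2$ be parity check matrices of $C_1$, $C_2$, of sizes $\rho_1\times n_1$ and $\rho_2\times n_2$. Let $\psi(C_2)$ be the code over $\mathrm{GF}(q)$ with parity check matrix $\psi(H_2)$, and let the tensor product code $C_2\otimes_H C_1$ be the code of length $n_1n_2$ over $\mathrm{GF}(q)$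 with parity check matrix $\psi(H_2\otimes\psi^{-1}(H_1))$. Put $C^{\perp}=\{v:\sum_i u_iv_i=0\ \forall u\in C\}$ and, for $q=4$, $C^{\perp_h}=\{v:\sum_i u_iv_i^2=0\ \forall u\in C\}$. A quantum tensor product code (QTPC) with component codes $A_1$, $A_2$ (and chosen parity check matrices) is a stabilizer code on $n_1n_2$ qubits whose stabilizer, up to phases in $\{\pm1,\pm i\}$, consists of the operators $X(a)Z(b)$ such that, with $\mathcal C=A_2\otimes_H A_1$: $a,b\in\mathcal C^{\perp}$ if $q=2$ (CSS construction); $\omega a+\omega^2b\in\mathcal C^{\perp_h}$ if $q=4$, where $\mathrm{GF}(4)=\{0,1,\omega,\omega^2\}$ (Hermitian construction). An $[[n,k,d]]$ code is a $2^k$-dimensional code on $n$ qubits with exact minimum distance $d$. It is pure if every operator $X(a)Z(b)$ of positive weight less than $d$ maps the code to a space orthogonal to it. Suppose that $q=2$ and ($C_1^{\perp}\subseteq C_1$ or $\psi(C_2)^{\perp}\subseteq\psi(C_2)$), or that $q=4$ and ($C_1^{\perp_h}\subseteq C_1$ or $\psi(C_2)^{\perp_h}\subseteq\psi(C_2)$).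 Then $2\rho_1\rho_2\le n_1n_2$, and: 1. There exists a pure QTPC with parameters $$[[\,n_1n_2,\ n_1n_2-2\rho_1\rho_2,\ \min\{d_1,d_2\}\,]].$$ Its component codes can be taken to be an $[n_1,k_1,d_1']_q$ code $C_1'$ and an $[n_2,k_2,d_2']_{q^{\rho_1}}$ code $C_2'$ with $\min\{d_1',d_2'\}=\min\{d_1,d_2\}$ and with $C_1'=C_1$ or $C_2'=C_2$. 2. For every choice of $H_1,H_2$, there is a QTPC with component codes $C_1$ and $C_2$ themselves that is a pure $[[n_1n_2,\ n_1n_2-2\rho_1\rho_2,\ d]]$ code with $d\ge\min\{d_1,d_2\}$, and with $d=\min\{d_1,d_2\}$ whenever $d_1\le d_2$. -/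

import Mathlib

open scoped Kronecker

/-! ### Classical linear codes -/

namespace QTPC

/-- `C` is an `[n, k, d]` linear code over `K` (coordinates indexed by `ι`): it has length `n`,
dimension `k`, and its least weight of a nonzero codeword is exactly `d`. -/
def IsLinearCode {K ι : Type*} [Field K] [DecidableEq K] [Fintype ι]
    (C : Submodule K (ι → K)) (n k d : ℕ) : Prop :=
  Fintype.card ι = n ∧ Module.finrank K C = k ∧
    IsLeast {w : ℕ | ∃ c ∈ C, c ≠ 0 ∧ hammingNorm c = w} d

/-- The Euclidean dual code `{c | x · c = 0 for all x ∈ C}`. -/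
def euclideanDual {K ι : Type*} [Field K] [Fintype ι] (C : Submodule K (ι → K)) : Set (ι → K) :=
  {c | ∀ x ∈ C, ∑ i, x i * c i = 0}

/-- The Hermitian dual code `{v | ∑ uᵢ vᵢ² = 0 for all u ∈ C}` (used over `GF(4)`). -/
def hermitianDual {K ι : Type*} [Field K] [Fintype ι] (C : Submodule K (ι → K)) : Set (ι → K) :=
  {v | ∀ u ∈ C, ∑ i, u i * v i ^ 2 = 0}

/-- The code whose parity check matrix is `H`. -/
def nullCode {K m ι : Type*} [Field K] [Fintype ι] (H : Matrix m ι K) : Submodule K (ι → K) :=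
  LinearMap.ker H.mulVecLin

/-- `H` is a parity check matrix of the `[n, k]` code `C`. The number `r` of rows is `n - k`,
so the rows are linearly independent. -/
def IsParityCheck {K : Type*} [Field K] {r n : ℕ} (H : Matrix (Fin r) (Fin n) K)
    (C : Submodule K (Fin n → K)) : Prop :=
  Module.finrank K C + r = n ∧ nullCode H = C

/-! ### The maps `ψ`, `ψ⁻¹` and the tensor product code -/

section Psi

variable {K F : Type*} [Field K] [Field F] [Algebra K F] {r : ℕ}

/-- `ψ(H)`: every entry of `H` is replaced by the column of its coordinates in the basis `b`. -/
noncomputable def psiMatrix (b : Module.Basis (Fin r) K F) {m n : Type*} (H : Matrix m n F) :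
    Matrix (m × Fin r) n K :=
  Matrix.of fun p j => b.repr (H p.1 j) p.2

/-- `ψ⁻¹(H)`: every column of `H` is replaced by the element of `F` with these coordinates. -/
noncomputable def psiInvMatrix (b : Module.Basis (Fin r) K F) {n : Type*} (H : Matrix (Fin r) n K) :
    Matrix (Fin 1) n F :=
  Matrix.of fun _ j => ∑ t, H t j • b t

/-- `ψ(C₂)`: the code over the subfield `K` with parity check matrix `ψ(H₂)`. -/
noncomputable def psiCode (b : Module.Basis (Fin r) K F) {m n : ℕ} (H₂ : Matrix (Fin m) (Fin n) F) :
    Submodule K (Fin n → K) :=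
  nullCode (psiMatrix b H₂)

/-- The tensor product code `C₂ ⊗_H C₁`: the code over `K` with parity check matrix
`ψ(H₂ ⊗ ψ⁻¹(H₁))`. Its coordinates `(j, i)` are the coordinate `i` of the block `j`. -/
noncomputable def tensorProductCode (b : Module.Basis (Fin r) K F) {m n₁ n₂ : ℕ}
    (H₁ : Matrix (Fin r) (Fin n₁) K) (H₂ : Matrix (Fin m) (Fin n₂) F) :
    Submodule K (Fin n₂ × Fin n₁ → K) :=
  nullCode (psiMatrix b (H₂ ⊗ₖ psiInvMatrix b H₁))

end Psi

/-! ### Qubits, Pauli operators and stabilizer codes -/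

/-- `X(a)|x⟩ = |x + a⟩` on one qubit. -/
def qubitX (a : ZMod 2) : Matrix (ZMod 2) (ZMod 2) ℂ :=
  Matrix.of fun y x => if y = x + a then 1 else 0

/-- `Z(b)|x⟩ = (-1)^{b x}|x⟩` on one qubit. -/
def qubitZ (b : ZMod 2) : Matrix (ZMod 2) (ZMod 2) ℂ :=
  Matrix.of fun y x => if y = x then (-1) ^ (b * x).val else 0

section Quantum

variable {ι : Type*} [Fintype ι]

/-- The tensor product of one-qubit operators, as a matrix in the basis `|x⟩`, `x ∈ GF(2)^ι`. -/
def qubitTensor (M : ι → Matrix (ZMod 2) (ZMod 2) ℂ) :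
    Matrix (ι → ZMod 2) (ι → ZMod 2) ℂ :=
  Matrix.of fun y x => ∏ i, M i (y i) (x i)

variable [DecidableEq ι]

/-- `X(a)Z(b)` for `a, b ∈ GF(2)^ι`. -/
def pauli (a b : ι → ZMod 2) : Matrix (ι → ZMod 2) (ι → ZMod 2) ℂ :=
  qubitTensor (fun i => qubitX (a i)) * qubitTensor (fun i => qubitZ (b i))

/-- The number of qubits on which `X(a)Z(b)` is not the identity. -/
def pauliWeight (a b : ι → ZMod 2) : ℕ :=
  (Finset.univ.filter fun i => a i ≠ 0 ∨ b i ≠ 0).card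

/-- `Q` is a stabilizer code whose stabilizer, up to phases, is `{X(a)Z(b) | (a|b) ∈ E}`: there is
a commutative group `S` of operators `i^k X(a)Z(b)`, the pairs `(a|b)` that occur are
exactly those in `E`, and `Q` is the space of all vectors fixed by `S`. -/
def IsStabilizerCodeWith (E : Set ((ι → ZMod 2) × (ι → ZMod 2)))
    (Q : Submodule ℂ ((ι → ZMod 2) → ℂ)) : Prop :=
  ∃ S : Subgroup (Matrix (ι → ZMod 2) (ι → ZMod 2) ℂ)ˣ,
    (∀ g ∈ S, ∀ h ∈ S, g * h = h * g) ∧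
    (∀ g ∈ S, ∃ e ∈ E, ∃ k : ℕ, g.val = Complex.I ^ k • pauli e.1 e.2) ∧
    (∀ e ∈ E, ∃ g ∈ S, ∃ k : ℕ, g.val = Complex.I ^ k • pauli e.1 e.2) ∧
    ∀ v, v ∈ Q ↔ ∀ g ∈ S, g.val.mulVec v = v

/-- The error `X(a)Z(b)` is detected by `Q`: `⟨u, X(a)Z(b) v⟩ = c ⟨u, v⟩` on `Q` with a
constant `c`. -/
def Detects (Q : Submodule ℂ ((ι → ZMod 2) → ℂ)) (a b : ι → ZMod 2) : Prop :=
  ∃ c : ℂ, ∀ u ∈ Q, ∀ v ∈ Q, star u ⬝ᵥ (pauli a b).mulVec v = c * (star u ⬝ᵥ v)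

/-- The error `X(a)Z(b)` maps `Q` to a space orthogonal to `Q`. -/
def MapsToOrthogonal (Q : Submodule ℂ ((ι → ZMod 2) → ℂ)) (a b : ι → ZMod 2) : Prop :=
  ∀ u ∈ Q, ∀ v ∈ Q, star u ⬝ᵥ (pauli a b).mulVec v = 0

/-- The minimum distance of `Q` is `d`: the least weight of an undetected error is `d`. For
one-dimensional `Q`, which detects every error, the usual convention takes instead the least weight
of an error other than the identity that does not map `Q` to a space orthogonal to `Q`. -/
def HasMinDist (Q : Submodule ℂ ((ι → ZMod 2) → ℂ)) (d : ℕ) : Prop :=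
  (Module.finrank ℂ Q ≠ 1 →
    IsLeast {w : ℕ | ∃ a b, ¬ Detects Q a b ∧ pauliWeight a b = w} d) ∧
  (Module.finrank ℂ Q = 1 →
    IsLeast {w : ℕ | ∃ a b, 0 < w ∧ ¬ MapsToOrthogonal Q a b ∧ pauliWeight a b = w} d)

/-- `Q` is an `[[n, k, d]]` quantum code (with exact minimum distance `d`). -/
def HasParameters (Q : Submodule ℂ ((ι → ZMod 2) → ℂ)) (n k d : ℕ) : Prop :=
  Fintype.card ι = n ∧ Module.finrank ℂ Q = 2 ^ k ∧ HasMinDist Q d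

/-- `Q` is pure to `d`: each error of positive weight less than `d` maps `Q` to a space orthogonal
to `Q`. For a stabilizer code this says that no stabilizer element has positive weight less
than `d` and that errors of weight less than `d` are detected. -/
def IsPureTo (Q : Submodule ℂ ((ι → ZMod 2) → ℂ)) (d : ℕ) : Prop :=
  ∀ a b, 0 < pauliWeight a b → pauliWeight a b < d → MapsToOrthogonal Q a b

variable {K : Type*} [Field K]

/-- The CSS construction from a binary code `C`: the stabilizer consists of the `X(a)Z(b)` with
`a, b ∈ C^⊥`. (Here `0, 1 ∈ GF(2)` are regarded as elements of `K`, a field of two elements.) -/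
def IsCSSCode (C : Submodule K (ι → K)) (Q : Submodule ℂ ((ι → ZMod 2) → ℂ)) : Prop :=
  IsStabilizerCodeWith
    {e | (fun i => ((e.1 i).val : K)) ∈ euclideanDual C ∧
         (fun i => ((e.2 i).val : K)) ∈ euclideanDual C} Q

/-- The Hermitian construction from a quaternary code `C`: the stabilizer consists, up to phases, of
the `X(a)Z(b)` with `ω a + ω² b ∈ C^{⊥h}`, where `GF(4) = {0, 1, ω, ω²}`. -/
def IsHermitianCode (ω : K) (C : Submodule K (ι → K)) (Q : Submodule ℂ ((ι → ZMod 2) → ℂ)) :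
    Prop :=
  IsStabilizerCodeWith
    {e | (fun i => ω * ((e.1 i).val : K) + ω ^ 2 * ((e.2 i).val : K)) ∈ hermitianDual C} Q

end Quantum

end QTPC

/-! Cut a word of length n₁n₂ into n₂ blocks of length n₁. The tensor product code T consists of the
words whose block syndromes under H₁, read as elements of GF(q^ρ₁), form a codeword of C₂
(`tensorProductCode_eq_syndromeCode`). If all syndromes of a nonzero word of T vanish, some block is
a nonzero word of C₁; otherwise at least d₂ blocks are nonzero. So the distance d of T is at least
min d₁ d₂, and d ≤ d₁ because C₁ embeds in a single block.

Pairing a word of the dual of T with words of T supported in one block or in one column shows that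
its blocks lie in the dual of C₁ and its columns in the dual of ψ(C₂). Hence either hypothesis makes
T contain its dual (`sesquilinearDual_syndromeCode_le`). The distance d is moreover attained outside
the dual (`exists_minDist_syndromeCode`), so the quantum distance is d and not larger. The Euclidean
and Hermitian duals are treated together, through a field map σ that is the identity or Frobenius.

On the quantum side the dual of T becomes an isotropic space E of pairs (a|b). Its Pauli operators,
with phases from `exists_quadratic_phase`, represent E; their average is the projector onto the
code, and traces give the dimension and the undetected errors (`exists_stabilizerCode`).

If d₂ < d₁, then d may exceed d₂, because the entries of a minimum word of C₂ need not be syndromes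
of blocks of weight one. Exactness then requires changing one component: scale the coordinates of C₂
if C₁ contains its dual, and otherwise lower the distance of C₁ to d₂. -/

namespace QTPC

/-! ### Pauli operators -/

/-- The character `x ↦ (-1)^x` of `GF(2)`. -/
def signChar (x : ZMod 2) : ℂ := (-1) ^ x.val

lemma signChar_zero : signChar 0 = 1 := by simp [signChar]

lemma signChar_add (x y : ZMod 2) : signChar (x + y) = signChar x * signChar y := by
  rw [signChar, signChar, signChar, ← pow_add, ZMod.val_add, ← neg_one_pow_eq_pow_mod_two]

lemma signChar_of_ne_zero {x : ZMod 2} (hx : x ≠ 0) : signChar x = -1 := by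
  fin_cases x
  · exact absurd rfl hx
  · simp [signChar, ZMod.val]

lemma signChar_mul_self (x : ZMod 2) : signChar x * signChar x = 1 := by
  rw [← signChar_add, CharTwo.add_self_eq_zero, signChar_zero]

lemma star_signChar (x : ZMod 2) : star (signChar x) = signChar x := by
  simp [signChar]

lemma signChar_sum {ι : Type*} (s : Finset ι) (f : ι → ZMod 2) :
    signChar (∑ i ∈ s, f i) = ∏ i ∈ s, signChar (f i) := by
  classical
  induction s using Finset.induction_on with
  | empty => simp [signChar_zero]
  | insert i s hi ih => rw [Finset.sum_insert hi, Finset.prod_insert hi, signChar_add, ih]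

section Pauli

variable {ι : Type*} [Fintype ι] [DecidableEq ι]

lemma pauli_apply (a b y x : ι → ZMod 2) :
    pauli a b y x = if y = x + a then signChar (b ⬝ᵥ x) else 0 := by
  have hX : ∀ y z : ι → ZMod 2,
      qubitTensor (fun i => qubitX (a i)) y z = if y = z + a then 1 else 0 := by
    intro y z
    simp only [qubitTensor, qubitX, Matrix.of_apply]
    split_ifs with h
    · exact Finset.prod_eq_one fun i _ => by simp [h]
    · obtain ⟨i, hi⟩ := Function.ne_iff.mp h
      exact Finset.prod_eq_zero (Finset.mem_univ i) (by simpa using hi)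
  have hZ : ∀ z x : ι → ZMod 2,
      qubitTensor (fun i => qubitZ (b i)) z x = if z = x then signChar (b ⬝ᵥ x) else 0 := by
    intro z x
    simp only [qubitTensor, qubitZ, Matrix.of_apply]
    split_ifs with h
    · subst h
      rw [dotProduct, signChar_sum]
      simp [signChar]
    · obtain ⟨i, hi⟩ := Function.ne_iff.mp h
      exact Finset.prod_eq_zero (Finset.mem_univ i) (by simpa using hi)
  rw [pauli, Matrix.mul_apply]
  simp only [hX, hZ]
  simp

lemma pauli_zero : pauli (0 : ι → ZMod 2) 0 = 1 := by
  ext y x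
  simp [pauli_apply, Matrix.one_apply, signChar_zero]

lemma pauli_mul (a b a' b' : ι → ZMod 2) :
    pauli a b * pauli a' b' = signChar (b ⬝ᵥ a') • pauli (a + a') (b + b') := by
  ext y x
  rw [Matrix.mul_apply, Matrix.smul_apply, pauli_apply]
  simp only [pauli_apply, mul_ite, mul_zero, Finset.sum_ite_eq', Finset.mem_univ, if_true]
  rw [add_assoc, add_comm a' a]
  split_ifs with h
  · rw [dotProduct_add, add_dotProduct, signChar_add, signChar_add, smul_eq_mul]
    ring
  · simp

lemma pauli_conjTranspose_mul_self (a b : ι → ZMod 2) :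
    (pauli a b).conjTranspose * pauli a b = 1 := by
  ext y x
  rw [Matrix.mul_apply, Matrix.one_apply]
  simp only [Matrix.conjTranspose_apply, pauli_apply, mul_ite, mul_zero, Finset.sum_ite_eq',
    Finset.mem_univ, if_true]
  by_cases h : y = x
  · subst h
    simp [star_signChar, signChar_mul_self]
  · have : ¬ x = y := fun h' => h h'.symm
    simp [h, this]

/-- Translating by a unit vector at a position where b is nonzero permutes the terms and flips every
sign. -/
lemma signChar_dotProduct_sum {b : ι → ZMod 2} (hb : b ≠ 0) :
    ∑ x : ι → ZMod 2, signChar (b ⬝ᵥ x) = 0 := by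
  obtain ⟨i, hi⟩ : ∃ i, b i ≠ 0 := Function.ne_iff.mp hb
  have hneg : ∀ x, signChar (b ⬝ᵥ (x + Pi.single i 1)) = - signChar (b ⬝ᵥ x) := fun x => by
    rw [dotProduct_add, dotProduct_single, mul_one, signChar_add, signChar_of_ne_zero hi, mul_neg,
      mul_one]
  have hs := Equiv.sum_comp (Equiv.addRight (Pi.single i (1 : ZMod 2)))
    fun x => signChar (b ⬝ᵥ x)
  simp only [Equiv.coe_addRight, hneg, Finset.sum_neg_distrib] at hs
  exact CharZero.eq_neg_self_iff.mp hs.symm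

lemma trace_pauli (a b : ι → ZMod 2) :
    (pauli a b).trace = if a = 0 ∧ b = 0 then 2 ^ Fintype.card ι else 0 := by
  simp only [Matrix.trace, Matrix.diag_apply, pauli_apply, left_eq_add]
  by_cases ha : a = 0
  · by_cases hb : b = 0
    · simp [ha, hb, signChar_zero]
    · simp [ha, hb, signChar_dotProduct_sum hb]
  · simp [ha]

end Pauli

/-! ### A choice of phases -/

/-- Lift coordinates and Gram matrix to {0, 1} and let q be the resulting integral value of B(e, e).
Changing a coordinate by 2 changes q by a multiple of 4, since B is symmetric, so q(x + y) = q(x) +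
q(y) + 2B(x, y) modulo 4. The phases i^q absorb the signs in products of commuting Pauli operators.
-/
lemma exists_quadratic_phase {E : Type*} [AddCommGroup E] [Module (ZMod 2) E]
    [Module.Finite (ZMod 2) E] (B : LinearMap.BilinForm (ZMod 2) E) (hB : ∀ x y, B x y = B y x) :
    ∃ q : E → ℕ, ∀ x y,
      Complex.I ^ q (x + y) = Complex.I ^ q x * Complex.I ^ q y * signChar (B x y) := by
  let v := Module.Free.chooseBasis (ZMod 2) E
  let X : E → _ → ℕ := fun e k => (v.repr e k).val
  let M : _ → _ → ℕ := fun k l => (B (v k) (v l)).val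
  have hM : ∀ k l, M k l = M l k := fun k l => by simp only [M, hB]
  let q : E → ℕ := fun e => ∑ k, ∑ l, X e k * X e l * M k l
  refine ⟨q, fun x y => ?_⟩
  have hB' : ((∑ k, ∑ l, X x k * X y l * M k l : ℕ) : ZMod 2) = B x y := by
    rw [← LinearMap.sum_repr_mul_repr_mul v v]
    simp [X, M, Finsupp.sum_fintype, mul_assoc]
  have hsign : signChar (B x y) = Complex.I ^ (2 * ∑ k, ∑ l, X x k * X y l * M k l) := by
    rw [pow_mul, Complex.I_sq, signChar, ← hB', ZMod.val_natCast]
    exact (neg_one_pow_eq_pow_mod_two _).symm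
  rw [hsign, ← pow_add, ← pow_add]
  have hmod : ∀ m n : ℕ, m ≡ n [MOD 4] → Complex.I ^ m = Complex.I ^ n := by
    intro m n h
    rw [Complex.I_pow_eq_pow_mod m, Complex.I_pow_eq_pow_mod n, h]
  apply hmod
  rw [← Int.natCast_modEq_iff]
  -- Here z is the carry in the binary addition of the lifted coordinates.
  have hcarry : ∀ k, ∃ z : ℤ, (X (x + y) k : ℤ) = X x k + X y k - 2 * z := by
    intro k
    have h2 : ((X (x + y) k : ℤ) : ZMod 2) = ((X x k + X y k : ℤ) : ZMod 2) := by simp [X]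
    obtain ⟨z, hz⟩ := (ZMod.intCast_eq_intCast_iff_dvd_sub _ _ 2).mp h2
    exact ⟨z, by push_cast at hz; linarith⟩
  choose z hz using hcarry
  have hsymm : ∀ f g : _ → ℤ, ∑ k, ∑ l, f k * g l * (M k l : ℤ) =
      ∑ k, ∑ l, g k * f l * (M k l : ℤ) := by
    intro f g
    rw [Finset.sum_comm]
    refine Finset.sum_congr rfl fun k _ => Finset.sum_congr rfl fun l _ => ?_
    rw [hM]; ring
  apply Int.ModEq.symm
  rw [Int.modEq_iff_dvd]
  -- The two mixed carry terms, each with coefficient -2, agree by symmetry and combine to -4; the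
  -- term quadratic in z already has coefficient 4.
  refine ⟨(∑ k, ∑ l, z k * z l * (M k l : ℤ)) -
    ∑ k, ∑ l, z k * ((X x l : ℤ) + X y l) * (M k l : ℤ), ?_⟩
  have h1 := hsymm (fun k => (X y k : ℤ)) (fun k => (X x k : ℤ))
  have h2 := hsymm (fun k => (X x k : ℤ) + X y k) z
  simp only [q]
  push_cast
  simp only [hz]
  have e1 : ∑ k, ∑ l, ((X x k : ℤ) + X y k - 2 * z k) * (X x l + X y l - 2 * z l) * (M k l : ℤ) =
      ∑ k, ∑ l, (X x k : ℤ) * X x l * M k l + ∑ k, ∑ l, (X y k : ℤ) * X y l * M k l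
      + ∑ k, ∑ l, (X x k : ℤ) * X y l * M k l + ∑ k, ∑ l, (X y k : ℤ) * X x l * M k l
      - 2 * ∑ k, ∑ l, z k * ((X x l : ℤ) + X y l) * (M k l : ℤ)
      - 2 * ∑ k, ∑ l, ((X x k : ℤ) + X y k) * z l * (M k l : ℤ)
      + 4 * ∑ k, ∑ l, z k * z l * (M k l : ℤ) := by
    simp only [Finset.mul_sum, ← Finset.sum_add_distrib, ← Finset.sum_sub_distrib]
    refine Finset.sum_congr rfl fun k _ => Finset.sum_congr rfl fun l _ => ?_
    ring
  rw [e1, h1, h2]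
  ring

/-! ### Stabilizer codes -/

section Stabilizer

variable {ι : Type*} [Fintype ι] [DecidableEq ι]

/-- The symplectic form on pairs `(a|b)`; it vanishes if and only if the corresponding Pauli
operators commute. -/
def symplecticForm (e f : (ι → ZMod 2) × (ι → ZMod 2)) : ZMod 2 :=
  e.2 ⬝ᵥ f.1 + f.2 ⬝ᵥ e.1

lemma pauli_mul_comm (e f : (ι → ZMod 2) × (ι → ZMod 2)) :
    pauli e.1 e.2 * pauli f.1 f.2 =
      signChar (symplecticForm e f) • (pauli f.1 f.2 * pauli e.1 e.2) := by
  rw [pauli_mul, pauli_mul, smul_smul, symplecticForm, signChar_add, mul_assoc, signChar_mul_self,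
    mul_one, add_comm f.1, add_comm f.2]

/-- The Pauli operators of an isotropic space, with suitable phases, form a representation. -/
lemma exists_pauli_monoidHom (E : Submodule (ZMod 2) ((ι → ZMod 2) × (ι → ZMod 2)))
    (hE : ∀ e ∈ E, ∀ f ∈ E, symplecticForm e f = 0) :
    ∃ ρ : Multiplicative E →* Matrix (ι → ZMod 2) (ι → ZMod 2) ℂ, ∃ q : E → ℕ,
      ∀ e : E, ρ (Multiplicative.ofAdd e) = Complex.I ^ q e • pauli e.1.1 e.1.2 := by
  let B : LinearMap.BilinForm (ZMod 2) E := LinearMap.mk₂ (ZMod 2)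
    (fun e f => e.1.2 ⬝ᵥ f.1.1) (fun _ _ _ => add_dotProduct _ _ _)
    (fun _ _ _ => smul_dotProduct _ _ _) (fun _ _ _ => dotProduct_add _ _ _)
    (fun _ _ _ => dotProduct_smul _ _ _)
  obtain ⟨q, hq⟩ := exists_quadratic_phase B
    fun e f => CharTwo.add_eq_zero.mp (hE e.1 e.2 f.1 f.2)
  have hq0 : Complex.I ^ q 0 = 1 := by
    have h := hq 0 0
    rw [add_zero, map_zero, signChar_zero, mul_one] at h
    exact (mul_eq_left₀ (pow_ne_zero _ Complex.I_ne_zero)).mp h.symm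
  refine ⟨⟨⟨fun e => Complex.I ^ q e.toAdd • pauli e.toAdd.1.1 e.toAdd.1.2, ?_⟩, ?_⟩, q,
    fun _ => rfl⟩
  · change Complex.I ^ q 0 • pauli 0 0 = 1
    rw [hq0, pauli_zero, one_smul]
  · intro e f
    change Complex.I ^ q (e.toAdd + f.toAdd) •
      pauli (e.toAdd.1.1 + f.toAdd.1.1) (e.toAdd.1.2 + f.toAdd.1.2) = _
    rw [smul_mul_smul_comm, pauli_mul, smul_smul, hq]
    rfl

lemma star_dotProduct_mulVec {n : Type*} [Fintype n] (A : Matrix n n ℂ) (u v : n → ℂ) :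
    star u ⬝ᵥ A.mulVec v = star (A.conjTranspose.mulVec u) ⬝ᵥ v := by
  rw [Matrix.star_mulVec, Matrix.conjTranspose_conjTranspose, Matrix.dotProduct_mulVec]

open scoped ComplexOrder in
/-- An isotropic space `E` gives a stabilizer code of dimension `2^n / |E|`, for which an error maps
the code to an orthogonal space if it does not commute with the stabilizer, and is not detected if
it commutes with the stabilizer without being in it. -/
theorem exists_stabilizerCode (E : Submodule (ZMod 2) ((ι → ZMod 2) × (ι → ZMod 2)))
    (hE : ∀ e ∈ E, ∀ f ∈ E, symplecticForm e f = 0) :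
    ∃ Q : Submodule ℂ ((ι → ZMod 2) → ℂ),
      IsStabilizerCodeWith (E : Set ((ι → ZMod 2) × (ι → ZMod 2))) Q ∧
      Nat.card E * Module.finrank ℂ Q = 2 ^ Fintype.card ι ∧
      (∀ f, (∃ e ∈ E, symplecticForm e f ≠ 0) → MapsToOrthogonal Q f.1 f.2) ∧
      (∀ f, (∀ e ∈ E, symplecticForm e f = 0) → f ∉ E → ¬ Detects Q f.1 f.2) := by
  classical
  obtain ⟨ρ, q, hρ⟩ := exists_pauli_monoidHom E hE
  have hρ' : ∀ g, ρ g = Complex.I ^ q g.toAdd • pauli g.toAdd.1.1 g.toAdd.1.2 := fun g => hρ g.toAdd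
  let Q : Submodule ℂ ((ι → ZMod 2) → ℂ) :=
    { carrier := {v | ∀ g, (ρ g).mulVec v = v}
      zero_mem' := fun g => Matrix.mulVec_zero _
      add_mem' := fun {u v} hu hv g => by rw [Matrix.mulVec_add, hu g, hv g]
      smul_mem' := fun c v hv g => by rw [Matrix.mulVec_smul, hv g] }
  have hQ : ∀ v, v ∈ Q ↔ ∀ g, (ρ g).mulVec v = v := fun v => Iff.rfl
  -- A is |E| times the projector onto Q. Only the identity of E contributes to its trace, which
  -- yields the dimension of Q.
  let A : Matrix (ι → ZMod 2) (ι → ZMod 2) ℂ := ∑ g, ρ g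
  have hAQ : ∀ v, A.mulVec v ∈ Q := fun v g => by
    rw [Matrix.mulVec_mulVec, Finset.mul_sum]
    simp only [← map_mul]
    exact congrArg (fun M => Matrix.mulVec M v) (Equiv.sum_comp (Equiv.mulLeft g) fun h => ρ h)
  have hAv : ∀ v ∈ Q, A.mulVec v = (Nat.card E : ℂ) • v := fun v hv => by
    rw [Matrix.sum_mulVec, Finset.sum_congr rfl fun g _ => hv g, Finset.sum_const,
      Finset.card_univ, Nat.card_eq_fintype_card, Fintype.card_multiplicative,
      Nat.cast_smul_eq_nsmul]
  have hcard : (Nat.card E : ℂ) ≠ 0 := Nat.cast_ne_zero.mpr Nat.card_pos.ne'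
  have htr : ∀ g, (ρ g).trace = if g = 1 then 2 ^ Fintype.card ι else 0 := fun g => by
    by_cases hg : g = 1
    · rw [if_pos hg, hg, map_one, Matrix.trace_one]
      simp [ZMod.card]
    · rw [if_neg hg, hρ', Matrix.trace_smul, trace_pauli, if_neg, smul_zero]
      rintro ⟨h1, h2⟩
      exact hg (Multiplicative.toAdd.injective (Subtype.ext (Prod.ext h1 h2)))
  have hAtr : A.trace = 2 ^ Fintype.card ι := by
    rw [Matrix.trace_sum, Finset.sum_congr rfl fun g _ => htr g, Finset.sum_ite_eq']
    simp
  have hrank : (Nat.card E : ℂ) * Module.finrank ℂ Q = 2 ^ Fintype.card ι := by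
    have hproj : LinearMap.IsProj Q (Matrix.toLin' ((Nat.card E : ℂ)⁻¹ • A)) := by
      constructor
      · intro v
        rw [Matrix.toLin'_apply, Matrix.smul_mulVec]
        exact Q.smul_mem _ (hAQ v)
      · intro v hv
        rw [Matrix.toLin'_apply, Matrix.smul_mulVec, hAv v hv, inv_smul_smul₀ hcard]
    have h := hproj.trace
    rw [Matrix.trace_toLin'_eq, Matrix.trace_smul, hAtr, smul_eq_mul] at h
    rw [← h, mul_inv_cancel_left₀ hcard]
  refine ⟨Q, ⟨ρ.toHomUnits.range, ?_, ?_, ?_, ?_⟩, by exact_mod_cast hrank, ?_, ?_⟩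
  · rintro _ ⟨g, rfl⟩ _ ⟨h, rfl⟩
    rw [← map_mul, ← map_mul, mul_comm]
  · rintro _ ⟨g, rfl⟩
    exact ⟨g.toAdd.1, g.toAdd.2, q g.toAdd, hρ' g⟩
  · intro e he
    exact ⟨_, ⟨Multiplicative.ofAdd ⟨e, he⟩, rfl⟩, q ⟨e, he⟩, hρ _⟩
  · intro v
    rw [hQ]
    exact ⟨fun h => by rintro _ ⟨g, rfl⟩; exact h g, fun h g => h _ ⟨g, rfl⟩⟩
  · rintro f ⟨e, he, hef⟩ u hu v hv
    let g : Multiplicative E := Multiplicative.ofAdd ⟨e, he⟩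
    have hanti : pauli f.1 f.2 * ρ g = - (ρ g * pauli f.1 f.2) := by
      rw [hρ', Matrix.mul_smul, Matrix.smul_mul]
      change _ = -(_ • (pauli e.1 e.2 * _))
      rw [pauli_mul_comm e f, signChar_of_ne_zero hef, neg_smul, smul_neg, one_smul, neg_neg]
      rfl
    have hu' : (ρ g).conjTranspose.mulVec u = u := by
      have h1 : (ρ g).conjTranspose * ρ g = 1 := by
        rw [hρ', Matrix.conjTranspose_smul, Matrix.smul_mul, Matrix.mul_smul, smul_smul,
          pauli_conjTranspose_mul_self, star_pow, ← mul_pow]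
        simp
      conv_lhs => rw [← hu g]
      rw [Matrix.mulVec_mulVec, h1, Matrix.one_mulVec]
    have h : star u ⬝ᵥ (pauli f.1 f.2).mulVec v = - (star u ⬝ᵥ (pauli f.1 f.2).mulVec v) := by
      conv_lhs => rw [← hv g]
      rw [Matrix.mulVec_mulVec, hanti, Matrix.neg_mulVec, dotProduct_neg, ← Matrix.mulVec_mulVec,
        star_dotProduct_mulVec, hu']
    exact CharZero.eq_neg_self_iff.mp h
  -- A detected P commuting with the stabilizer would act on Q as the scalar c, so PA = cA. As f is
  -- not in E, no product of P with a stabilizer element is scalar, so PA has trace 0. Since A has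
  -- nonzero trace, c = 0, and invertibility of P gives A = 0, a contradiction.
  · rintro f hf hfE ⟨c, hc⟩
    have hPQ : ∀ v ∈ Q, (pauli f.1 f.2).mulVec v ∈ Q := fun v hv g => by
      have hcomm : ρ g * pauli f.1 f.2 = pauli f.1 f.2 * ρ g := by
        rw [hρ', Matrix.mul_smul, Matrix.smul_mul, pauli_mul_comm g.toAdd.1 f,
          hf _ g.toAdd.2, signChar_zero, one_smul]
      rw [Matrix.mulVec_mulVec, hcomm, ← Matrix.mulVec_mulVec, hv g]
    have hPv : ∀ v ∈ Q, (pauli f.1 f.2).mulVec v = c • v := fun v hv => by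
      -- The vector Pv - cv lies in Q, so it may be tested against itself and has norm zero.
      have hw := Q.sub_mem (hPQ v hv) (Q.smul_mem c hv)
      have h := hc _ hw v hv
      rw [← sub_eq_zero, ← smul_eq_mul, ← dotProduct_smul, ← dotProduct_sub] at h
      exact sub_eq_zero.mp (dotProduct_star_self_eq_zero.mp h)
    have hPA : pauli f.1 f.2 * A = c • A := by
      refine Matrix.toLin'.injective (LinearMap.ext fun v => ?_)
      rw [Matrix.toLin'_apply, Matrix.toLin'_apply, ← Matrix.mulVec_mulVec, hPv _ (hAQ v),
        Matrix.smul_mulVec]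
    have htr0 : (pauli f.1 f.2 * A).trace = 0 := by
      rw [Finset.mul_sum, Matrix.trace_sum]
      refine Finset.sum_eq_zero fun g _ => ?_
      rw [hρ', Matrix.mul_smul, pauli_mul, Matrix.trace_smul, Matrix.trace_smul, trace_pauli,
        if_neg, smul_zero, smul_zero]
      rintro ⟨h1, h2⟩
      apply hfE
      have : f = g.toAdd.1 := Prod.ext
        (funext fun i => CharTwo.add_eq_zero.mp (congrFun h1 i))
        (funext fun i => CharTwo.add_eq_zero.mp (congrFun h2 i))
      rw [this]
      exact g.toAdd.2
    rw [hPA, Matrix.trace_smul, hAtr, smul_eq_mul, mul_eq_zero] at htr0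
    have hc0 : c = 0 := htr0.resolve_right (pow_ne_zero _ two_ne_zero)
    have hA0 : A = 0 := by
      rw [hc0, zero_smul] at hPA
      rw [← Matrix.one_mul A, ← pauli_conjTranspose_mul_self f.1 f.2, Matrix.mul_assoc, hPA,
        Matrix.mul_zero]
    rw [hA0, Matrix.trace_zero] at hAtr
    exact pow_ne_zero _ two_ne_zero hAtr.symm

lemma MapsToOrthogonal.detects {Q : Submodule ℂ ((ι → ZMod 2) → ℂ)} {a b : ι → ZMod 2}
    (h : MapsToOrthogonal Q a b) : Detects Q a b :=
  ⟨0, fun u hu v hv => by rw [h u hu v hv, zero_mul]⟩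

lemma detects_of_pauliWeight_eq_zero (Q : Submodule ℂ ((ι → ZMod 2) → ℂ)) {a b : ι → ZMod 2}
    (h : pauliWeight a b = 0) : Detects Q a b := by
  rw [pauliWeight, Finset.card_eq_zero, Finset.filter_eq_empty_iff] at h
  push Not at h
  have ha : a = 0 := funext fun i => (h (Finset.mem_univ i)).1
  have hb : b = 0 := funext fun i => (h (Finset.mem_univ i)).2
  exact ⟨1, fun u _ v _ => by rw [ha, hb, pauli_zero, Matrix.one_mulVec, one_mul]⟩

/-- The parameters of the pure stabilizer code of an isotropic space `E` of size `2^r` such that the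
least weight of a nonzero element of the symplectic dual is `d`, and is attained outside `E`. -/
theorem exists_pure_stabilizerCode (E : Submodule (ZMod 2) ((ι → ZMod 2) × (ι → ZMod 2)))
    (hE : ∀ e ∈ E, ∀ f ∈ E, symplecticForm e f = 0) {r d : ℕ} (hr : Nat.card E = 2 ^ r)
    (hd : ∀ f, (∀ e ∈ E, symplecticForm e f = 0) → 0 < pauliWeight f.1 f.2 →
      d ≤ pauliWeight f.1 f.2)
    (f : (ι → ZMod 2) × (ι → ZMod 2)) (hf : ∀ e ∈ E, symplecticForm e f = 0) (hfE : f ∉ E)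
    (hfd : pauliWeight f.1 f.2 = d) :
    ∃ Q : Submodule ℂ ((ι → ZMod 2) → ℂ),
      IsStabilizerCodeWith (E : Set ((ι → ZMod 2) × (ι → ZMod 2))) Q ∧
      r ≤ Fintype.card ι ∧
      HasParameters Q (Fintype.card ι) (Fintype.card ι - r) d ∧ IsPureTo Q d := by
  obtain ⟨Q, hQ, hrank, horth, hdet⟩ := exists_stabilizerCode E hE
  rw [hr] at hrank
  -- Divisibility of 2^n by |E| = 2^r is the source of the bound 2ρ₁ρ₂ ≤ n₁n₂.
  have hle : r ≤ Fintype.card ι :=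
    (Nat.pow_dvd_pow_iff_le_right (by norm_num)).mp (Dvd.intro _ hrank)
  have hfdet := hdet f hf hfE
  have hpure : ∀ a b, 0 < pauliWeight a b → ¬ MapsToOrthogonal Q a b → d ≤ pauliWeight a b := by
    intro a b hpos hab
    refine hd (a, b) (fun e he => ?_) hpos
    by_contra hne
    exact hab (horth (a, b) ⟨e, he, hne⟩)
  -- The undetected f is neither the identity nor an error mapping Q to an orthogonal space, so it
  -- attains d under both distance conventions.
  refine ⟨Q, hQ, hle, ⟨rfl, ?_, fun _ => ⟨⟨f.1, f.2, hfdet, hfd⟩, ?_⟩, fun _ =>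
    ⟨⟨f.1, f.2, ?_, fun h => hfdet h.detects, hfd⟩, ?_⟩⟩, ?_⟩
  · rw [← Nat.add_sub_of_le hle, pow_add] at hrank
    exact Nat.eq_of_mul_eq_mul_left (by positivity) hrank
  · rintro _ ⟨a, b, hab, rfl⟩
    refine hpure a b (Nat.pos_of_ne_zero fun h => hab (detects_of_pauliWeight_eq_zero Q h)) fun h =>
      hab h.detects
  · exact hfd ▸ Nat.pos_of_ne_zero fun h => hfdet (detects_of_pauliWeight_eq_zero Q h)
  · rintro _ ⟨a, b, hpos, hab, rfl⟩
    exact hpure a b hpos hab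
  · intro a b hpos hlt
    by_contra hab
    exact absurd (hpure a b hpos hab) (not_le.mpr hlt)

end Stabilizer

/-! ### Dual codes with respect to an involution of the field -/

section Dual

variable {K ι : Type*} [Field K] [Fintype ι]

/-- The dual code `{v | ∑ uᵢ σ(vᵢ) = 0 for all u ∈ C}`. -/
def sesquilinearDual (σ : K →+* K) (C : Submodule K (ι → K)) : Submodule K (ι → K) where
  carrier := {v | ∀ u ∈ C, ∑ i, u i * σ (v i) = 0}
  zero_mem' := fun u _ => by simp
  add_mem' := fun {v w} hv hw u hu => by
    simp [mul_add, Finset.sum_add_distrib, hv u hu, hw u hu]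
  smul_mem' := fun c v hv u hu => by
    simp only [Pi.smul_apply, smul_eq_mul, map_mul, mul_left_comm _ (σ c), ← Finset.mul_sum,
      hv u hu, mul_zero]

variable (K ι) in
/-- The dot product as a bilinear form. -/
def dotForm : LinearMap.BilinForm K (ι → K) := dotProductBilin K K

lemma dotForm_apply (u v : ι → K) : dotForm K ι u v = ∑ i, u i * v i := rfl

lemma dotForm_isRefl : (dotForm K ι).IsRefl := fun u v h => by
  rw [dotForm_apply] at h ⊢
  simpa only [mul_comm] using h

lemma dotForm_nondegenerate : (dotForm K ι).Nondegenerate := by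
  classical
  refine (LinearMap.IsRefl.nondegenerate_iff_separatingLeft (B := dotForm K ι)
    dotForm_isRefl).mpr fun u hu => ?_
  exact dotProduct_eq_zero_iff.mp hu

lemma mem_sesquilinearDual_iff_mem_orthogonal {σ : K →+* K} {C : Submodule K (ι → K)}
    {v : ι → K} :
    v ∈ sesquilinearDual σ C ↔ (fun i => σ (v i)) ∈ (dotForm K ι).orthogonal C := Iff.rfl

/-- Biduality: applying the involution σ to the entries reduces it to the double orthogonal of the
dot product. -/
lemma mem_of_forall_mem_sesquilinearDual {σ : K →+* K} (hσ : ∀ x, σ (σ x) = x)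
    {C : Submodule K (ι → K)} {v : ι → K}
    (hv : ∀ u ∈ sesquilinearDual σ C, ∑ i, u i * σ (v i) = 0) : v ∈ C := by
  rw [← LinearMap.BilinForm.orthogonal_orthogonal dotForm_nondegenerate dotForm_isRefl C]
  intro u hu
  have h := hv (fun i => σ (u i)) (by
    rw [mem_sesquilinearDual_iff_mem_orthogonal]
    simpa only [hσ] using hu)
  simp only [← map_mul, ← map_sum] at h
  exact (map_eq_zero σ).mp h

lemma card_sesquilinearDual [Finite K] {σ : K →+* K} (hσ : ∀ x, σ (σ x) = x)
    {C : Submodule K (ι → K)} {r : ℕ} (hr : Module.finrank K C + r = Fintype.card ι) :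
    Nat.card (sesquilinearDual σ C) = Nat.card K ^ r := by
  have hcard : Nat.card (sesquilinearDual σ C) = Nat.card ((dotForm K ι).orthogonal C) := by
    refine Nat.card_congr ⟨fun v => ⟨fun i => σ (v.1 i), v.2⟩, fun v => ⟨fun i => σ (v.1 i), ?_⟩,
      fun v => Subtype.ext (funext fun i => hσ _), fun v => Subtype.ext (funext fun i => hσ _)⟩
    rw [mem_sesquilinearDual_iff_mem_orthogonal]
    simpa only [hσ] using v.2
  rw [hcard, Module.natCard_eq_pow_finrank (K := K),
    LinearMap.BilinForm.finrank_orthogonal dotForm_nondegenerate,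
    Module.finrank_fintype_fun_eq_card, ← hr, Nat.add_sub_cancel_left]

end Dual

/-! ### The CSS and Hermitian constructions -/

section Constructions

variable {K ι : Type*} [Field K] [Fintype ι]

lemma natCast_val_eq_map (ε : ZMod 2 →+* K) (x : ZMod 2) : ((x.val : ℕ) : K) = ε x := by
  rw [← map_natCast ε, ZMod.natCast_zmod_val]

lemma hammingNorm_le_pauliWeight_left (a b : ι → ZMod 2) : hammingNorm a ≤ pauliWeight a b :=
  Finset.card_le_card (Finset.monotone_filter_right _ fun _ _ h => Or.inl h)

lemma hammingNorm_le_pauliWeight_right (a b : ι → ZMod 2) : hammingNorm b ≤ pauliWeight a b :=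
  Finset.card_le_card (Finset.monotone_filter_right _ fun _ _ h => Or.inr h)

/-- E is a product of two copies of the dual of C, and its symplectic dual is C × C. The weight of a
pair is at least that of either component, so nonzero pairs there have weight at least d. -/
theorem exists_CSSCode [DecidableEq K] [DecidableEq ι] (hK : Nat.card K = 2)
    (C : Submodule K (ι → K)) {r d : ℕ}
    (hr : Module.finrank K C + r = Fintype.card ι)
    (hDC : sesquilinearDual (RingHom.id K) C ≤ C) (hd : ∀ c ∈ C, c ≠ 0 → d ≤ hammingNorm c)
    {c : ι → K} (hc : c ∈ C) (hcD : c ∉ sesquilinearDual (RingHom.id K) C)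
    (hcd : hammingNorm c = d) :
    ∃ Q : Submodule ℂ ((ι → ZMod 2) → ℂ), IsCSSCode C Q ∧ 2 * r ≤ Fintype.card ι ∧
      HasParameters Q (Fintype.card ι) (Fintype.card ι - 2 * r) d ∧ IsPureTo Q d := by
  have : Finite K := Nat.finite_of_card_ne_zero (by omega)
  have : Fintype K := Fintype.ofFinite K
  have hK' : Fintype.card K = 2 := by rw [← Nat.card_eq_fintype_card, hK]
  have : CharP K 2 := charP_of_card_eq_prime hK'
  let ε : ZMod 2 ≃+* K := ZMod.ringEquiv K hK'
  have hε : ∀ x : ZMod 2, ((x.val : ℕ) : K) = ε x := natCast_val_eq_map ε.toRingHom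
  let D := sesquilinearDual (RingHom.id K) C
  have hform : ∀ a b : ι → ZMod 2, ε (a ⬝ᵥ b) = ∑ i, ε (a i) * ε (b i) := fun a b => by
    simp [dotProduct]
  have h0 : (fun i => ε ((0 : ι → ZMod 2) i)) = 0 := funext fun _ => map_zero ε
  have hadd : ∀ a b : ι → ZMod 2,
      (fun i => ε ((a + b) i)) = (fun i => ε (a i)) + fun i => ε (b i) :=
    fun a b => funext fun _ => map_add ε _ _
  have hsmul : ∀ (x : ZMod 2) (a : ι → ZMod 2),
      (fun i => ε ((x • a) i)) = ε x • fun i => ε (a i) :=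
    fun x a => funext fun _ => map_mul ε _ _
  let E : Submodule (ZMod 2) ((ι → ZMod 2) × (ι → ZMod 2)) :=
    { carrier := {e | (fun i => ((e.1 i).val : K)) ∈ euclideanDual C ∧
        (fun i => ((e.2 i).val : K)) ∈ euclideanDual C}
      zero_mem' := by
        simp only [hε]
        have := (congrArg (· ∈ D) h0).mpr D.zero_mem
        exact ⟨this, this⟩
      add_mem' := by
        simp only [hε]
        rintro e f ⟨he1, he2⟩ ⟨hf1, hf2⟩
        exact ⟨(congrArg (· ∈ D) (hadd e.1 f.1)).mpr (D.add_mem he1 hf1),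
          (congrArg (· ∈ D) (hadd e.2 f.2)).mpr (D.add_mem he2 hf2)⟩
      smul_mem' := by
        simp only [hε]
        rintro x e ⟨he1, he2⟩
        exact ⟨(congrArg (· ∈ D) (hsmul x e.1)).mpr (D.smul_mem _ he1),
          (congrArg (· ∈ D) (hsmul x e.2)).mpr (D.smul_mem _ he2)⟩ }
  have hE : ∀ e, e ∈ E ↔ (fun i => ε (e.1 i)) ∈ D ∧ (fun i => ε (e.2 i)) ∈ D := fun e => by
    simp only [← hε]
    rfl
  have hcardE : Nat.card E = 2 ^ (2 * r) := by
    have hcardD : Nat.card D = 2 ^ r := by rw [card_sesquilinearDual (fun _ => rfl) hr, hK]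
    rw [two_mul, pow_add, ← hcardD, ← Nat.card_prod]
    refine Nat.card_congr ⟨fun e => (⟨_, ((hE e.1).mp e.2).1⟩, ⟨_, ((hE e.1).mp e.2).2⟩),
      fun u => ⟨(fun i => ε.symm (u.1.1 i), fun i => ε.symm (u.2.1 i)), ?_⟩, fun e => ?_,
      fun u => ?_⟩
    · rw [hE]
      simp
    · simp
    · simp
  have hnorm : ∀ a : ι → ZMod 2, hammingNorm (fun i => ε (a i)) = hammingNorm a := fun a =>
    hammingNorm_comp (fun _ => ε) (fun _ => ε.injective) fun _ => map_zero ε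
  have hiso : ∀ e ∈ E, ∀ f ∈ E, symplecticForm e f = 0 := by
    intro e he f hf
    rw [hE] at he hf
    apply ε.injective
    rw [symplecticForm, map_add, hform, hform, map_zero]
    exact (congrArg₂ _ (hf.1 _ (hDC he.2)) (he.1 _ (hDC hf.2))).trans (add_zero 0)
  have hdual : ∀ f, (∀ e ∈ E, symplecticForm e f = 0) →
      (fun i => ε (f.1 i)) ∈ C ∧ (fun i => ε (f.2 i)) ∈ C := by
    intro f hf
    constructor
    -- Pairing with (0|u) isolates the first component; below, (u|0) isolates the second.
    · refine mem_of_forall_mem_sesquilinearDual (σ := RingHom.id K) (fun _ => rfl) fun u hu => ?_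
      have h := hf (0, fun i => ε.symm (u i)) ((hE _).mpr ⟨(congrArg (· ∈ D) h0).mpr D.zero_mem,
        by simpa using hu⟩)
      simpa [symplecticForm, hform] using congrArg ε h
    · refine mem_of_forall_mem_sesquilinearDual (σ := RingHom.id K) (fun _ => rfl) fun u hu => ?_
      have h := hf (fun i => ε.symm (u i), 0) ((hE _).mpr ⟨by simpa using hu,
        (congrArg (· ∈ D) h0).mpr D.zero_mem⟩)
      simpa [symplecticForm, hform, mul_comm] using congrArg ε h
  -- The pair (c|0) has the weight of c and lies in the symplectic dual, outside E.
  refine exists_pure_stabilizerCode E hiso hcardE (d := d) (fun f hf hpos => ?_)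
    (fun i => ε.symm (c i), 0) ?_ ?_ ?_
  · by_cases h1 : f.1 = 0
    · have h2 : f.2 ≠ 0 := fun h2 => by simp [pauliWeight, h1, h2] at hpos
      refine le_trans (hd _ (hdual f hf).2 fun h0 => h2 ?_)
        ((hnorm f.2).trans_le (hammingNorm_le_pauliWeight_right f.1 f.2))
      exact funext fun i => (map_eq_zero_iff ε ε.injective).mp (congrFun h0 i)
    · refine le_trans (hd _ (hdual f hf).1 fun h0 => h1 ?_)
        ((hnorm f.1).trans_le (hammingNorm_le_pauliWeight_left f.1 f.2))
      exact funext fun i => (map_eq_zero_iff ε ε.injective).mp (congrFun h0 i)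
  · intro e he
    apply ε.injective
    have h := ((hE e).mp he).2 c hc
    simpa [symplecticForm, hform, mul_comm] using h
  · intro h
    apply hcD
    simpa using ((hE _).mp h).1
  · rw [← hcd]
    simp [pauliWeight, hammingNorm]

lemma sum_omega_eq_zero_iff [CharP K 2] {ω : K} (hω : ω ^ 2 + ω + 1 = 0) (ε : ZMod 2 →+* K)
    (s t : ZMod 2) : ω * ε s + ω ^ 2 * ε t = 0 ↔ s = 0 ∧ t = 0 := by
  have hω0 : ω ≠ 0 := by rintro rfl; simp at hω
  have hω1 : ω + ω ^ 2 ≠ 0 := fun h => one_ne_zero (α := K) (by linear_combination hω - h)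
  have h01 : ∀ x : ZMod 2, x = 0 ∨ x = 1 := by decide
  rcases h01 s with rfl | rfl <;> rcases h01 t with rfl | rfl <;> simp [hω0, hω1]

/-- The left side is the trace to GF(2) of the Hermitian product. The products ss' and tt' have
coefficient ω³ = 1, of trace 0; the mixed ones have coefficient ω or ω², of trace 1. -/
lemma trace_hermitian_product [CharP K 2] {ω : K} (hω : ω ^ 2 + ω + 1 = 0) (ε : ZMod 2 →+* K)
    (hK : ∀ x : K, x ^ 4 = x) (s t s' t' : ZMod 2) :
    (ω * ε s + ω ^ 2 * ε t) * (ω * ε s' + ω ^ 2 * ε t') ^ 2 +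
      ((ω * ε s + ω ^ 2 * ε t) * (ω * ε s' + ω ^ 2 * ε t') ^ 2) ^ 2 = ε (t * s' + t' * s) := by
  have hsq : ∀ x : ZMod 2, ε x ^ 2 = ε x := fun x => by
    rw [← map_pow, ZMod.pow_card]
  have hadd : ∀ x y : K, (x + y) ^ 2 = x ^ 2 + y ^ 2 := fun x y => CharTwo.add_sq x y
  have h2 : (2 : K) = 0 := CharTwo.two_eq_zero
  have h3 : ω ^ 3 = 1 := by linear_combination (ω - 1) * hω
  have hu : ∀ x y : ZMod 2, (ω * ε x + ω ^ 2 * ε y) ^ 2 = ω ^ 2 * ε x + ω * ε y := fun x y => by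
    rw [hadd, mul_pow, mul_pow, hsq, hsq]
    linear_combination ω * ε y * h3
  rw [mul_pow, ← pow_mul, hK, hu, hu, map_add, map_mul, map_mul]
  linear_combination (ε s * ε s' + ε t * ε t') * ω ^ 3 * h2 +
    (ε t * ε s' + ε t' * ε s) * ω * h3 + (ε t * ε s' + ε t' * ε s) * (hω - h2)

/-- Under (a|b) ↦ ωa + ω²b weights agree and the symplectic form is the trace of the Hermitian
product. Since the Hermitian dual is GF(4)-linear, vanishing traces force vanishing products, so the
symplectic dual of E corresponds to C. -/
theorem exists_hermitianCode [DecidableEq K] [DecidableEq ι] (hK : Nat.card K = 4) [CharP K 2]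
    {ω : K} (hω : ω ^ 2 + ω + 1 = 0)
    (C : Submodule K (ι → K)) {r d : ℕ} (hr : Module.finrank K C + r = Fintype.card ι)
    (hDC : sesquilinearDual (frobenius K 2) C ≤ C) (hd : ∀ c ∈ C, c ≠ 0 → d ≤ hammingNorm c)
    {c : ι → K} (hc : c ∈ C) (hcD : c ∉ sesquilinearDual (frobenius K 2) C)
    (hcd : hammingNorm c = d) :
    ∃ Q : Submodule ℂ ((ι → ZMod 2) → ℂ), IsHermitianCode ω C Q ∧ 2 * r ≤ Fintype.card ι ∧
      HasParameters Q (Fintype.card ι) (Fintype.card ι - 2 * r) d ∧ IsPureTo Q d := by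
  have : Finite K := Nat.finite_of_card_ne_zero (by omega)
  have : Fintype K := Fintype.ofFinite K
  have hK' : Fintype.card K = 4 := by rw [← Nat.card_eq_fintype_card, hK]
  have hpow : ∀ x : K, x ^ 4 = x := fun x => by rw [← hK', FiniteField.pow_card]
  have hσ : ∀ x : K, frobenius K 2 (frobenius K 2 x) = x := fun x => by
    rw [frobenius_def, frobenius_def, ← pow_mul, hpow]
  let ε : ZMod 2 →+* K := ZMod.castHom dvd_rfl K
  have hε : ∀ x : ZMod 2, ((x.val : ℕ) : K) = ε x := natCast_val_eq_map ε
  let θ : ZMod 2 × ZMod 2 →+ K :=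
    { toFun := fun x => ω * ε x.1 + ω ^ 2 * ε x.2
      map_zero' := by simp
      map_add' := fun x y => by simp only [Prod.fst_add, Prod.snd_add, map_add]; ring }
  have hθ0 : ∀ s t, θ (s, t) = 0 ↔ s = 0 ∧ t = 0 := sum_omega_eq_zero_iff hω ε
  have hθ : Function.Bijective θ := by
    rw [Fintype.bijective_iff_injective_and_card, hK']
    refine ⟨(injective_iff_map_eq_zero θ).mpr fun x hx => ?_, by simp⟩
    obtain ⟨h1, h2⟩ := (hθ0 x.1 x.2).mp hx
    exact Prod.ext h1 h2
  let D := sesquilinearDual (frobenius K 2) C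
  let φ : (ι → ZMod 2) × (ι → ZMod 2) → ι → K := fun e i => θ (e.1 i, e.2 i)
  have hφ : Function.Bijective φ := by
    constructor
    · intro e f h
      have h' : ∀ i, (e.1 i, e.2 i) = (f.1 i, f.2 i) := fun i => hθ.1 (congrFun h i)
      exact Prod.ext (funext fun i => congrArg Prod.fst (h' i))
        (funext fun i => congrArg Prod.snd (h' i))
    · intro u
      choose x hx using fun i => hθ.2 (u i)
      exact ⟨(fun i => (x i).1, fun i => (x i).2), funext hx⟩
  have hφadd : ∀ e f, φ (e + f) = φ e + φ f := fun e f => funext fun i =>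
    map_add θ (e.1 i, e.2 i) (f.1 i, f.2 i)
  have hφsmul : ∀ (x : ZMod 2) e, φ (x • e) = ε x • φ e := fun x e => funext fun i => by
    change ω * ε (x * e.1 i) + ω ^ 2 * ε (x * e.2 i) = ε x * (ω * ε (e.1 i) + ω ^ 2 * ε (e.2 i))
    rw [map_mul, map_mul]
    ring
  have hφ0 : φ 0 = 0 := funext fun i => map_zero θ
  have hφweight : ∀ e, pauliWeight e.1 e.2 = hammingNorm (φ e) := fun e => by
    rw [pauliWeight, hammingNorm]
    refine congrArg Finset.card (Finset.filter_congr fun i _ => ?_)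
    rw [Ne, Ne, ← not_and_or, ← hθ0]
  have hform : ∀ e f, (∑ i, φ e i * φ f i ^ 2) + (∑ i, φ e i * φ f i ^ 2) ^ 2 =
      ε (symplecticForm e f) := fun e f => by
    rw [CharTwo.sum_sq, ← Finset.sum_add_distrib, symplecticForm, dotProduct, dotProduct,
      ← Finset.sum_add_distrib, map_sum]
    exact Finset.sum_congr rfl fun i _ => trace_hermitian_product hω ε hpow _ _ _ _
  let E : Submodule (ZMod 2) ((ι → ZMod 2) × (ι → ZMod 2)) :=
    { carrier := {e | (fun i => ω * ((e.1 i).val : K) + ω ^ 2 * ((e.2 i).val : K)) ∈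
        hermitianDual C}
      zero_mem' := by
        simp only [hε]
        exact (congrArg (· ∈ D) hφ0).mpr D.zero_mem
      add_mem' := by
        simp only [hε]
        intro e f he hf
        exact (congrArg (· ∈ D) (hφadd e f)).mpr (D.add_mem he hf)
      smul_mem' := by
        simp only [hε]
        intro x e he
        exact (congrArg (· ∈ D) (hφsmul x e)).mpr (D.smul_mem (ε x) he) }
  have hE : ∀ e, e ∈ E ↔ φ e ∈ D := fun e => by
    have : φ e = fun i => ω * ((e.1 i).val : K) + ω ^ 2 * ((e.2 i).val : K) := by
      simp only [hε]
      rfl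
    rw [this]
    rfl
  have hcardE : Nat.card E = 2 ^ (2 * r) := by
    rw [pow_mul, show 2 ^ 2 = Nat.card K by rw [hK]; rfl, ← card_sesquilinearDual hσ hr]
    exact Nat.card_congr ((Equiv.ofBijective φ hφ).subtypeEquiv hE)
  have hiso : ∀ e f, φ e ∈ C → φ f ∈ D → symplecticForm e f = 0 := by
    intro e f he hf
    apply ε.injective
    have h0 : ∑ i, φ e i * φ f i ^ 2 = 0 := hf _ he
    rw [← hform, h0, map_zero]
    ring
  have hsymm : ∀ e f : (ι → ZMod 2) × (ι → ZMod 2), symplecticForm e f = symplecticForm f e :=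
    fun e f => add_comm _ _
  have hdual : ∀ f, (∀ e ∈ E, symplecticForm e f = 0) → φ f ∈ C := by
    intro f hf
    refine mem_of_forall_mem_sesquilinearDual hσ fun u hu => ?_
    by_contra hne
    set h := ∑ i, u i * frobenius K 2 (φ f i) with hh
    -- Rescaling u makes the product ω, whose trace ω + ω² = 1 is nonzero.
    obtain ⟨e, he⟩ := hφ.2 ((ω / h) • u)
    have heq := hform e f
    have hsum : ∑ i, φ e i * φ f i ^ 2 = ω := by
      rw [he]
      simp only [Pi.smul_apply, smul_eq_mul, mul_assoc, ← Finset.mul_sum]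
      exact div_mul_cancel₀ ω hne
    rw [hf e ((hE e).mpr (he ▸ D.smul_mem _ hu)), hsum, map_zero] at heq
    exact one_ne_zero (α := K) (by linear_combination hω - heq)
  obtain ⟨f, hf⟩ := hφ.2 c
  refine exists_pure_stabilizerCode E
    (fun e he f hf => hiso e f (hDC ((hE e).mp he)) ((hE f).mp hf)) hcardE (d := d)
    (fun f hf hpos => ?_) f (fun e he => ?_) ?_ ?_
  · rw [hφweight] at hpos ⊢
    exact hd _ (hdual f hf) (hammingNorm_pos_iff.mp hpos)
  · rw [hsymm]
    exact hiso f e (hf ▸ hc) ((hE e).mp he)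
  · rw [hE, hf]
    exact hcD
  · rw [hφweight, hf, hcd]

end Constructions

/-! ### Codes of words whose block syndromes form a codeword -/

section SyndromeCode

variable {K F ι₁ ι₂ : Type*} [Field K] [Field F] [Algebra K F]

/-- The words whose blocks have syndromes that form a codeword of `C₂`. -/
def syndromeCode (S : (ι₁ → K) →ₗ[K] F) (C₂ : Submodule F (ι₂ → F)) :
    Submodule K (ι₂ × ι₁ → K) :=
  (C₂.restrictScalars K).comap
    (LinearMap.pi fun j => S ∘ₗ LinearMap.funLeft K K fun i => (j, i))

lemma mem_syndromeCode {S : (ι₁ → K) →ₗ[K] F} {C₂ : Submodule F (ι₂ → F)} {c : ι₂ × ι₁ → K} :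
    c ∈ syndromeCode S C₂ ↔ (fun j => S fun i => c (j, i)) ∈ C₂ := Iff.rfl

/-- The codewords of `C₂` with entries in the subfield `K`. -/
def subfieldSubcode (K : Type*) [Field K] [Algebra K F] (C₂ : Submodule F (ι₂ → F)) :
    Submodule K (ι₂ → K) :=
  (C₂.restrictScalars K).comap ((Algebra.linearMap K F).compLeft ι₂)

/-- The word with block `w` at position `j` and zeros elsewhere. -/
def blockWord [DecidableEq ι₂] (j : ι₂) (w : ι₁ → K) : ι₂ × ι₁ → K :=
  fun p => if p.1 = j then w p.2 else 0

/-- The word with the entries of `u` at position `i` of the blocks and zeros elsewhere. -/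
def columnWord [DecidableEq ι₁] (i : ι₁) (u : ι₂ → K) : ι₂ × ι₁ → K :=
  fun p => if p.2 = i then u p.1 else 0

lemma blockWord_mem_syndromeCode [DecidableEq ι₂] {S : (ι₁ → K) →ₗ[K] F}
    (C₂ : Submodule F (ι₂ → F)) (j : ι₂) {w : ι₁ → K} (hw : S w = 0) :
    blockWord j w ∈ syndromeCode S C₂ := by
  rw [mem_syndromeCode]
  convert C₂.zero_mem using 1
  refine funext fun j' => ?_
  by_cases h : j' = j
  · simpa [blockWord, h] using hw
  · simp only [blockWord, h, if_false]
    exact map_zero S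

lemma map_columnWord [DecidableEq ι₁] (S : (ι₁ → K) →ₗ[K] F) (i : ι₁) (u : ι₂ → K) (j : ι₂) :
    (S fun i' => columnWord i u (j, i')) = u j • S (Pi.single i 1) := by
  rw [← map_smul]
  refine congrArg S (funext fun i' => ?_)
  simp [columnWord, Pi.single_apply]

lemma columnWord_mem_syndromeCode [DecidableEq ι₁] (S : (ι₁ → K) →ₗ[K] F)
    {C₂ : Submodule F (ι₂ → F)} (i : ι₁) {u : ι₂ → K} (hu : u ∈ subfieldSubcode K C₂) :
    columnWord i u ∈ syndromeCode S C₂ := by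
  rw [mem_syndromeCode]
  convert C₂.smul_mem (S (Pi.single i 1)) hu using 1
  refine funext fun j => ?_
  rw [map_columnWord, Algebra.smul_def, mul_comm]
  rfl

variable [Fintype ι₁] [Fintype ι₂]

lemma sum_blockWord_mul [DecidableEq ι₂] (j : ι₂) (w : ι₁ → K) (f : ι₂ × ι₁ → K) :
    ∑ p, blockWord j w p * f p = ∑ i, w i * f (j, i) := by
  rw [Fintype.sum_prod_type, Finset.sum_eq_single j]
  · simp [blockWord]
  · intro j' _ h
    simp [blockWord, h]
  · simp

lemma sum_columnWord_mul [DecidableEq ι₁] (i : ι₁) (u : ι₂ → K) (f : ι₂ × ι₁ → K) :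
    ∑ p, columnWord i u p * f p = ∑ j, u j * f (j, i) := by
  rw [Fintype.sum_prod_type_right, Finset.sum_eq_single i]
  · simp [columnWord]
  · intro i' _ h
    simp [columnWord, h]
  · simp

lemma block_mem_sesquilinearDual [DecidableEq ι₂] {σ : K →+* K} {S : (ι₁ → K) →ₗ[K] F}
    {C₂ : Submodule F (ι₂ → F)} {y : ι₂ × ι₁ → K}
    (hy : y ∈ sesquilinearDual σ (syndromeCode S C₂)) (j : ι₂) :
    (fun i => y (j, i)) ∈ sesquilinearDual σ (LinearMap.ker S) := by
  intro w hw
  rw [← hy _ (blockWord_mem_syndromeCode C₂ j hw), sum_blockWord_mul j w fun p => σ (y p)]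

lemma column_mem_sesquilinearDual [DecidableEq ι₁] {σ : K →+* K} {S : (ι₁ → K) →ₗ[K] F}
    {C₂ : Submodule F (ι₂ → F)} {y : ι₂ × ι₁ → K}
    (hy : y ∈ sesquilinearDual σ (syndromeCode S C₂)) (i : ι₁) :
    (fun j => y (j, i)) ∈ sesquilinearDual σ (subfieldSubcode K C₂) := by
  intro u hu
  rw [← hy _ (columnWord_mem_syndromeCode S i hu), sum_columnWord_mul i u fun p => σ (y p)]

lemma sesquilinearDual_syndromeCode_le {σ : K →+* K} {S : (ι₁ → K) →ₗ[K] F}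
    {C₂ : Submodule F (ι₂ → F)}
    (h : sesquilinearDual σ (LinearMap.ker S) ≤ LinearMap.ker S ∨
      sesquilinearDual σ (subfieldSubcode K C₂) ≤ subfieldSubcode K C₂) :
    sesquilinearDual σ (syndromeCode S C₂) ≤ syndromeCode S C₂ := by
  classical
  intro y hy
  rcases h with h | h
  · rw [mem_syndromeCode]
    convert C₂.zero_mem using 1
    exact funext fun j => h (block_mem_sesquilinearDual hy j)
  -- Each column of y lies in the subfield subcode, hence is by itself a word of the syndrome code.
  · have hsum : y = ∑ i, columnWord i fun j => y (j, i) := by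
      ext ⟨j, i⟩
      simp [columnWord]
    rw [hsum]
    exact Submodule.sum_mem _ fun i _ =>
      columnWord_mem_syndromeCode S i (h (column_mem_sesquilinearDual hy i))

/-! ### Weights -/

variable [DecidableEq K] [DecidableEq F]

lemma hammingNorm_block_le (c : ι₂ × ι₁ → K) (j : ι₂) :
    hammingNorm (fun i => c (j, i)) ≤ hammingNorm c :=
  Finset.card_le_card_of_injOn (fun i => (j, i)) (fun i hi => by simpa using hi)
    fun _ _ _ _ h => congrArg Prod.snd h

lemma hammingNorm_column_le (c : ι₂ × ι₁ → K) (i : ι₁) :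
    hammingNorm (fun j => c (j, i)) ≤ hammingNorm c :=
  Finset.card_le_card_of_injOn (fun j => (j, i)) (fun i hi => by simpa using hi)
    fun _ _ _ _ h => congrArg Prod.fst h

lemma hammingNorm_blockWord [DecidableEq ι₂] (j : ι₂) (w : ι₁ → K) :
    hammingNorm (blockWord j w) = hammingNorm w := by
  refine le_antisymm (Finset.card_le_card_of_injOn Prod.snd (fun p hp => ?_) ?_) ?_
  · simp only [blockWord, Finset.coe_filter, Finset.mem_univ, true_and, Set.mem_ofPred_eq,
      ne_eq, ite_eq_right_iff, Classical.not_imp] at hp ⊢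
    exact hp.2
  · intro p hp q hq h
    simp only [blockWord, Finset.coe_filter, Finset.mem_univ, true_and, Set.mem_ofPred_eq,
      ne_eq, ite_eq_right_iff, Classical.not_imp] at hp hq
    exact Prod.ext (hp.1.trans hq.1.symm) h
  · simpa [blockWord] using hammingNorm_block_le (blockWord j w) j

lemma hammingNorm_columnWord [DecidableEq ι₁] (i : ι₁) (u : ι₂ → K) :
    hammingNorm (columnWord i u) = hammingNorm u := by
  refine le_antisymm (Finset.card_le_card_of_injOn Prod.fst (fun p hp => ?_) ?_) ?_
  · simp only [columnWord, Finset.coe_filter, Finset.mem_univ, true_and, Set.mem_ofPred_eq,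
      ne_eq, ite_eq_right_iff, Classical.not_imp] at hp ⊢
    exact hp.2
  · intro p hp q hq h
    simp only [columnWord, Finset.coe_filter, Finset.mem_univ, true_and, Set.mem_ofPred_eq,
      ne_eq, ite_eq_right_iff, Classical.not_imp] at hp hq
    exact Prod.ext h (hp.1.trans hq.1.symm)
  · simpa [columnWord] using hammingNorm_column_le (columnWord i u) i

lemma hammingNorm_syndrome_le (S : (ι₁ → K) →ₗ[K] F) (c : ι₂ × ι₁ → K) :
    hammingNorm (fun j => S fun i => c (j, i)) ≤ hammingNorm c := by
  classical
  refine le_trans (Finset.card_le_card fun j hj => ?_)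
    (Finset.card_image_le (s := Finset.univ.filter fun p => c p ≠ 0) (f := Prod.fst))
  simp only [Finset.mem_filter, Finset.mem_univ, true_and] at hj
  simp only [Finset.mem_image, Finset.mem_filter, Finset.mem_univ, true_and, Prod.exists,
    exists_and_right, exists_eq_right]
  by_contra! h
  apply hj
  rw [show (fun i => c (j, i)) = 0 from funext h, map_zero]

lemma min_le_hammingNorm_of_mem_syndromeCode {S : (ι₁ → K) →ₗ[K] F} {C₂ : Submodule F (ι₂ → F)}
    {d₁ d₂ : ℕ} (hd₁ : ∀ w, S w = 0 → w ≠ 0 → d₁ ≤ hammingNorm w)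
    (hd₂ : ∀ x ∈ C₂, x ≠ 0 → d₂ ≤ hammingNorm x) {c : ι₂ × ι₁ → K}
    (hc : c ∈ syndromeCode S C₂) (hc0 : c ≠ 0) : min d₁ d₂ ≤ hammingNorm c := by
  by_cases hs : (fun j => S fun i => c (j, i)) = 0
  · obtain ⟨⟨j, i⟩, hji⟩ := Function.ne_iff.mp hc0
    exact (min_le_left _ _).trans ((hd₁ _ (congrFun hs j) fun h => hji (congrFun h i)).trans
      (hammingNorm_block_le c j))
  · exact (min_le_right _ _).trans ((hd₂ _ hc hs).trans (hammingNorm_syndrome_le S c))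

-- Surjectivity of S lets a multiple of x be realized by blocks of which block j is the unit vector
-- at a position in the support of w; this word of the code pairs nontrivially with the block word.
omit [DecidableEq K] [DecidableEq F] in
lemma blockWord_notMem_sesquilinearDual [DecidableEq ι₂] {σ : K →+* K} {S : (ι₁ → K) →ₗ[K] F}
    (hS : Function.Surjective S) {C₂ : Submodule F (ι₂ → F)} {x : ι₂ → F} (hx : x ∈ C₂) {j : ι₂}
    (hxj : x j ≠ 0) {w : ι₁ → K} (hw : w ≠ 0) :
    blockWord j w ∉ sesquilinearDual σ (syndromeCode S C₂) := by
  classical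
  intro h
  obtain ⟨i, hi⟩ : ∃ i, w i ≠ 0 := Function.ne_iff.mp hw
  -- Chosen so that entry j of lam • x is the syndrome of the unit vector.
  let lam : F := S (Pi.single i 1) / x j
  choose v hv using fun j' => hS (lam * x j')
  let u : ι₂ × ι₁ → K := fun p => if p.1 = j then (Pi.single i 1 : ι₁ → K) p.2 else v p.1 p.2
  have hu : u ∈ syndromeCode S C₂ := by
    rw [mem_syndromeCode]
    convert C₂.smul_mem lam hx using 1
    refine funext fun j' => ?_
    by_cases hj : j' = j
    · subst hj
      simp only [u, if_true, Pi.smul_apply, smul_eq_mul, lam]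
      rw [div_mul_cancel₀ _ hxj]
    · simp only [u, hj, if_false]
      exact hv j'
  have h0 := h u hu
  have hcomm : ∀ p, u p * σ (blockWord j w p) =
      blockWord j (fun i => σ (w i)) p * u p := fun p => by
    by_cases hp : p.1 = j <;> simp [blockWord, hp, mul_comm]
  rw [Finset.sum_congr rfl fun p _ => hcomm p, sum_blockWord_mul] at h0
  simp [u, Pi.single_apply, hi] at h0

-- The word w placed in a block where u is nonzero meets column i in one position, so their pairing
-- is a single nonzero product.
omit [DecidableEq K] [DecidableEq F] in
lemma columnWord_notMem_sesquilinearDual [DecidableEq ι₁] {σ : K →+* K} {S : (ι₁ → K) →ₗ[K] F}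
    (C₂ : Submodule F (ι₂ → F)) {w : ι₁ → K} (hw : S w = 0) {i : ι₁} (hwi : w i ≠ 0)
    {u : ι₂ → K} (hu : u ≠ 0) :
    columnWord i u ∉ sesquilinearDual σ (syndromeCode S C₂) := by
  classical
  intro h
  obtain ⟨j, hj⟩ : ∃ j, u j ≠ 0 := Function.ne_iff.mp hu
  have h0 := h _ (blockWord_mem_syndromeCode C₂ j hw)
  rw [sum_blockWord_mul j w fun p => σ (columnWord i u p)] at h0
  simp [columnWord, apply_ite σ, hwi, hj] at h0

/-- The minimum distance of a dual containing syndrome code is attained outside of its dual. -/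
theorem exists_minDist_syndromeCode {σ : K →+* K} {S : (ι₁ → K) →ₗ[K] F}
    (hS : Function.Surjective S) {C₂ : Submodule F (ι₂ → F)} {d₁ d₂ : ℕ}
    (hd₁ : IsLeast {w : ℕ | ∃ c ∈ LinearMap.ker S, c ≠ 0 ∧ hammingNorm c = w} d₁)
    (hd₂ : IsLeast {w : ℕ | ∃ c ∈ C₂, c ≠ 0 ∧ hammingNorm c = w} d₂)
    (h : sesquilinearDual σ (LinearMap.ker S) ≤ LinearMap.ker S ∨
      sesquilinearDual σ (subfieldSubcode K C₂) ≤ subfieldSubcode K C₂) :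
    ∃ d, min d₁ d₂ ≤ d ∧ d ≤ d₁ ∧ (∀ c ∈ syndromeCode S C₂, c ≠ 0 → d ≤ hammingNorm c) ∧
      ∃ c ∈ syndromeCode S C₂, c ∉ sesquilinearDual σ (syndromeCode S C₂) ∧ hammingNorm c = d := by
  classical
  obtain ⟨⟨w, hw, hw0, hwd⟩, hmin₁⟩ := hd₁
  obtain ⟨⟨x, hx, hx0, -⟩, hmin₂⟩ := hd₂
  obtain ⟨j, hxj⟩ : ∃ j, x j ≠ 0 := Function.ne_iff.mp hx0
  obtain ⟨i, hwi⟩ : ∃ i, w i ≠ 0 := Function.ne_iff.mp hw0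
  have hbT := blockWord_mem_syndromeCode C₂ j hw
  have hbD := blockWord_notMem_sesquilinearDual (σ := σ) hS hx hxj hw0
  have hb0 : blockWord j w ≠ 0 := fun h0 => hbD (h0 ▸ Submodule.zero_mem _)
  have hex : ∃ d, ∃ c ∈ syndromeCode S C₂, c ≠ 0 ∧ hammingNorm c = d :=
    ⟨_, _, hbT, hb0, rfl⟩
  obtain ⟨c, hc, hc0, hcd⟩ := Nat.find_spec hex
  have hmin : ∀ c ∈ syndromeCode S C₂, c ≠ 0 → Nat.find hex ≤ hammingNorm c :=
    fun c hc hc0 => Nat.find_min' hex ⟨c, hc, hc0, rfl⟩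
  refine ⟨Nat.find hex, ?_, ?_, hmin, ?_⟩
  · rw [← hcd]
    exact min_le_hammingNorm_of_mem_syndromeCode (fun v hv hv0 => hmin₁ ⟨v, hv, hv0, rfl⟩)
      (fun v hv hv0 => hmin₂ ⟨v, hv, hv0, rfl⟩) hc hc0
  · rw [← hwd, ← hammingNorm_blockWord j w]
    exact hmin _ hbT hb0
  -- If c is in the dual, replace it: either a block of c is a nonzero word of the kernel, so w in
  -- one block is no heavier, or a nonzero column of c moves to position i, where w is nonzero.
  · by_cases hcD : c ∈ sesquilinearDual σ (syndromeCode S C₂)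
    · obtain ⟨⟨j', i'⟩, hji⟩ := Function.ne_iff.mp hc0
      rcases h with h | h
      · refine ⟨_, hbT, hbD, le_antisymm ?_ (hmin _ hbT hb0)⟩
        rw [hammingNorm_blockWord, hwd, ← hcd]
        exact (hmin₁ ⟨_, h (block_mem_sesquilinearDual hcD j'), fun h0 => hji (congrFun h0 i'),
          rfl⟩).trans (hammingNorm_block_le c j')
      · have hT := columnWord_mem_syndromeCode S i (h (column_mem_sesquilinearDual hcD i'))
        have hD := columnWord_notMem_sesquilinearDual (σ := σ) C₂ hw hwi
          (u := fun j => c (j, i')) fun h0 => hji (congrFun h0 j')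
        refine ⟨_, hT, hD, le_antisymm ?_ (hmin _ hT fun h0 => hD (h0 ▸ Submodule.zero_mem _))⟩
        rw [hammingNorm_columnWord, ← hcd]
        exact hammingNorm_column_le c i'
    · exact ⟨c, hc, hcD, hcd⟩

end SyndromeCode

/-! ### Tensor product codes as syndrome codes -/

section TensorProduct

variable {K F : Type*} [Field K] [Field F] [Algebra K F]

lemma mem_nullCode {m ι : Type*} [Fintype ι] {H : Matrix m ι K} {v : ι → K} :
    v ∈ nullCode H ↔ H.mulVec v = 0 := by
  rw [nullCode, LinearMap.mem_ker, Matrix.mulVecLin_apply]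

/-- The syndrome with respect to `H`, as an element of `F`. -/
noncomputable def psiSyndrome {r n : ℕ} (b : Module.Basis (Fin r) K F)
    (H : Matrix (Fin r) (Fin n) K) : (Fin n → K) →ₗ[K] F :=
  b.equivFun.symm.toLinearMap ∘ₗ H.mulVecLin

lemma psiSyndrome_apply {r n : ℕ} (b : Module.Basis (Fin r) K F)
    (H : Matrix (Fin r) (Fin n) K) (w : Fin n → K) :
    psiSyndrome b H w = ∑ i, w i • psiInvMatrix b H 0 i := by
  simp only [psiSyndrome, LinearMap.comp_apply, Matrix.mulVecLin_apply, LinearEquiv.coe_coe,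
    Module.Basis.equivFun_symm_apply, psiInvMatrix, Matrix.of_apply, Matrix.mulVec, dotProduct,
    Finset.sum_smul, Finset.smul_sum, smul_smul]
  rw [Finset.sum_comm]
  simp only [mul_comm]

lemma ker_psiSyndrome {r n : ℕ} (b : Module.Basis (Fin r) K F) (H : Matrix (Fin r) (Fin n) K) :
    LinearMap.ker (psiSyndrome b H) = nullCode H := by
  rw [psiSyndrome, LinearEquiv.ker_comp, nullCode]

lemma IsParityCheck.mulVec_surjective {r n : ℕ} {H : Matrix (Fin r) (Fin n) K}
    {C : Submodule K (Fin n → K)} (h : IsParityCheck H C) : Function.Surjective H.mulVecLin := by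
  obtain ⟨hr, rfl⟩ := h
  rw [← LinearMap.range_eq_top]
  apply Submodule.eq_top_of_finrank_eq
  have h1 := LinearMap.finrank_range_add_finrank_ker H.mulVecLin
  have h2 : Module.finrank K (LinearMap.ker H.mulVecLin) + r = n := hr
  rw [Module.finrank_fin_fun] at h1 ⊢
  omega

lemma IsParityCheck.psiSyndrome_surjective {r n : ℕ} (b : Module.Basis (Fin r) K F)
    {H : Matrix (Fin r) (Fin n) K} {C : Submodule K (Fin n → K)} (h : IsParityCheck H C) :
    Function.Surjective (psiSyndrome b H) :=
  b.equivFun.symm.surjective.comp h.mulVec_surjective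

lemma psiMatrix_mulVec {r : ℕ} (b : Module.Basis (Fin r) K F) {m n : Type*} [Fintype n]
    (H : Matrix m n F) (v : n → K) (p : m × Fin r) :
    (psiMatrix b H).mulVec v p = b.repr (H.mulVec (fun j => algebraMap K F (v j)) p.1) p.2 := by
  simp only [Matrix.mulVec, dotProduct, psiMatrix, Matrix.of_apply, map_sum, Finsupp.coe_finsetSum,
    Finset.sum_apply]
  refine Finset.sum_congr rfl fun j _ => ?_
  rw [mul_comm (H p.1 j), ← Algebra.smul_def, map_smul, Finsupp.smul_apply, smul_eq_mul, mul_comm]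

lemma mem_nullCode_psiMatrix {r : ℕ} (b : Module.Basis (Fin r) K F) {m n : Type*} [Fintype n]
    (H : Matrix m n F) (v : n → K) :
    v ∈ nullCode (psiMatrix b H) ↔ (fun j => algebraMap K F (v j)) ∈ nullCode H := by
  rw [mem_nullCode, mem_nullCode]
  constructor
  · intro h
    funext i
    refine b.repr.map_eq_zero_iff.mp (Finsupp.ext fun t => ?_)
    rw [← psiMatrix_mulVec b H v (i, t), h]
    rfl
  · intro h
    funext p
    rw [psiMatrix_mulVec, h]
    simp

lemma psiCode_eq_subfieldSubcode {r m n : ℕ} (b : Module.Basis (Fin r) K F)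
    (H : Matrix (Fin m) (Fin n) F) : psiCode b H = subfieldSubcode K (nullCode H) :=
  Submodule.ext fun v => mem_nullCode_psiMatrix b H v

lemma tensorProductCode_eq_syndromeCode {r m n₁ n₂ : ℕ} (b : Module.Basis (Fin r) K F)
    (H₁ : Matrix (Fin r) (Fin n₁) K) (H₂ : Matrix (Fin m) (Fin n₂) F) :
    tensorProductCode b H₁ H₂ = syndromeCode (psiSyndrome b H₁) (nullCode H₂) := by
  ext c
  rw [tensorProductCode, mem_nullCode_psiMatrix, mem_syndromeCode, mem_nullCode, mem_nullCode]
  have h : ∀ p : Fin m × Fin 1,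
      (H₂ ⊗ₖ psiInvMatrix b H₁).mulVec (fun q => algebraMap K F (c q)) p =
        H₂.mulVec (fun j => psiSyndrome b H₁ fun i => c (j, i)) p.1 := by
    intro p
    simp only [Matrix.mulVec, dotProduct, Fintype.sum_prod_type, Matrix.kroneckerMap_apply,
      psiSyndrome_apply, Finset.mul_sum]
    refine Finset.sum_congr rfl fun j _ => Finset.sum_congr rfl fun i _ => ?_
    rw [Algebra.smul_def, Subsingleton.elim p.2 0]
    ring
  constructor
  · intro h0
    funext i
    rw [← h (i, 0), h0]
    rfl
  · intro h0
    funext p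
    rw [h, h0]
    rfl

/-- Block syndromes followed by H₂ form a surjection onto F^m, of dimension rm over K, with the code
as kernel. -/
lemma finrank_tensorProductCode {r m n₁ n₂ : ℕ} (b : Module.Basis (Fin r) K F)
    {H₁ : Matrix (Fin r) (Fin n₁) K} {H₂ : Matrix (Fin m) (Fin n₂) F}
    {C₁ : Submodule K (Fin n₁ → K)} {C₂ : Submodule F (Fin n₂ → F)} (h₁ : IsParityCheck H₁ C₁)
    (h₂ : IsParityCheck H₂ C₂) :
    Module.finrank K (tensorProductCode b H₁ H₂) + r * m =
      Fintype.card (Fin n₂ × Fin n₁) := by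
  let T : (Fin n₂ × Fin n₁ → K) →ₗ[K] (Fin m → F) := H₂.mulVecLin.restrictScalars K ∘ₗ
    LinearMap.pi fun j => psiSyndrome b H₁ ∘ₗ LinearMap.funLeft K K fun i => (j, i)
  have hker : LinearMap.ker T = tensorProductCode b H₁ H₂ := by
    rw [tensorProductCode_eq_syndromeCode]
    rfl
  have hsurj : Function.Surjective T := by
    intro y
    obtain ⟨x, hx⟩ := h₂.mulVec_surjective y
    choose w hw using fun j => h₁.psiSyndrome_surjective b (x j)
    refine ⟨fun p => w p.1 p.2, ?_⟩
    rw [← hx]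
    exact congrArg H₂.mulVecLin (funext hw)
  have : Module.Finite K F := Module.Finite.of_basis b
  have h := LinearMap.finrank_range_add_finrank_ker T
  rw [LinearMap.range_eq_top.mpr hsurj, finrank_top, hker, Module.finrank_fintype_fun_eq_card,
    Module.finrank_pi_fintype, Finset.sum_const, Module.finrank_eq_card_basis b] at h
  simp only [Finset.card_univ, Fintype.card_fin, smul_eq_mul] at h
  rw [← h, mul_comm r m, add_comm]

end TensorProduct

/-! ### Modifications of linear codes -/

section LinearCodes

variable {K ι : Type*} [Field K] [Fintype ι]

lemma IsLinearCode.pos [DecidableEq K] {C : Submodule K (ι → K)} {n k d : ℕ}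
    (h : IsLinearCode C n k d) : 0 < d := by
  obtain ⟨c, -, hc0, rfl⟩ := h.2.2.1
  exact hammingNorm_pos_iff.mpr hc0

lemma exists_isParityCheck {n r : ℕ} (C : Submodule K (Fin n → K))
    (h : Module.finrank K C + r = n) : ∃ H : Matrix (Fin r) (Fin n) K, IsParityCheck H C := by
  have hq : Module.finrank K ((Fin n → K) ⧸ C) = Module.finrank K (Fin r → K) := by
    have := C.finrank_quotient_add_finrank
    rw [Module.finrank_fin_fun] at this ⊢
    omega
  let e := LinearEquiv.ofFinrankEq _ _ hq
  refine ⟨LinearMap.toMatrix' (e.toLinearMap ∘ₗ C.mkQ), h, ?_⟩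
  rw [nullCode, ← Matrix.toLin'_apply', Matrix.toLin'_toMatrix', LinearEquiv.ker_comp,
    Submodule.ker_mkQ]

variable [DecidableEq K]

/-- Replacing a coordinate of the codewords by zero. -/
lemma exists_isLinearCode_of_succ {C : Submodule K (ι → K)} {n k d : ℕ}
    (h : IsLinearCode C n k (d + 1)) (hd : 0 < d) :
    ∃ C' : Submodule K (ι → K), IsLinearCode C' n k d := by
  classical
  obtain ⟨hn, hk, ⟨c, hc, hc0, hcd⟩, hmin⟩ := h
  obtain ⟨i, hi⟩ : ∃ i, c i ≠ 0 := Function.ne_iff.mp hc0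
  let L : (ι → K) →ₗ[K] (ι → K) :=
    LinearMap.pi fun j => if j = i then 0 else LinearMap.proj j
  have hL : ∀ x j, L x j = if j = i then 0 else x j := fun x j => by
    by_cases hj : j = i <;> simp [L, hj]
  have hsupp : ∀ x, (Finset.univ.filter fun j => L x j ≠ 0) =
      (Finset.univ.filter fun j => x j ≠ 0).erase i := fun x => by
    ext j
    simp [hL]
  have hwle : ∀ x, hammingNorm x ≤ hammingNorm (L x) + 1 := fun x => by
    rw [hammingNorm, hammingNorm, hsupp]
    have := Finset.pred_card_le_card_erase (a := i) (s := Finset.univ.filter fun j => x j ≠ 0)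
    omega
  have hcw : hammingNorm (L c) = d := by
    rw [hammingNorm, hsupp, Finset.card_erase_of_mem (by simpa using hi)]
    exact Nat.sub_eq_of_eq_add hcd
  -- A word killed by L has weight at most 1, below the minimum distance d + 1 ≥ 2.
  have hinj : Function.Injective (L.domRestrict C) := by
    rw [← LinearMap.ker_eq_bot, LinearMap.ker_eq_bot']
    intro x hx
    by_contra hne
    have h1 := hmin ⟨x.1, x.2, fun h0 => hne (Subtype.ext h0), rfl⟩
    have h2 := hwle x.1
    rw [show L x.1 = 0 from hx, hammingNorm_zero] at h2
    omega
  refine ⟨C.map L, hn, ?_, ⟨L c, Submodule.mem_map_of_mem hc, ?_, hcw⟩, ?_⟩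
  · rw [← LinearMap.range_domRestrict, LinearMap.finrank_range_of_inj hinj, hk]
  · rintro h0
    rw [h0, hammingNorm_zero] at hcw
    omega
  · rintro _ ⟨_, ⟨x, hx, rfl⟩, hx0, rfl⟩
    have h1 := hmin ⟨x, hx, fun h0 => hx0 (by rw [h0, map_zero]), rfl⟩
    have h2 := hwle x
    omega

/-- The minimum distance of a linear code can be lowered keeping its length and dimension. -/
lemma exists_isLinearCode_of_le {C : Submodule K (ι → K)} {n k d d' : ℕ}
    (h : IsLinearCode C n k d) (hd' : 0 < d') (hle : d' ≤ d) :
    ∃ C' : Submodule K (ι → K), IsLinearCode C' n k d' := by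
  induction d, hle using Nat.le_induction generalizing C with
  | base => exact ⟨C, h⟩
  | succ d hd ih =>
    obtain ⟨C', hC'⟩ := exists_isLinearCode_of_succ h (hd'.trans_le hd)
    exact ih hC'

/-- The code of all `x` with `(gⱼ xⱼ) ∈ C`. -/
def scaledCode (g : ι → Kˣ) (C : Submodule K (ι → K)) : Submodule K (ι → K) :=
  C.comap (LinearEquiv.piCongrRight fun j => LinearEquiv.smulOfUnit (g j)).toLinearMap

omit [Fintype ι] [DecidableEq K] in
lemma mem_scaledCode {g : ι → Kˣ} {C : Submodule K (ι → K)} {x : ι → K} :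
    x ∈ scaledCode g C ↔ (fun j => (g j : K) * x j) ∈ C := Iff.rfl

omit [Fintype ι] [DecidableEq K] in
lemma finrank_scaledCode (g : ι → Kˣ) (C : Submodule K (ι → K)) :
    Module.finrank K (scaledCode g C) = Module.finrank K C := by
  rw [scaledCode, Submodule.comap_equiv_eq_map_symm]
  exact LinearEquiv.finrank_map_eq _ _

lemma hammingNorm_units_mul (g : ι → Kˣ) (x : ι → K) :
    hammingNorm (fun j => (g j : K) * x j) = hammingNorm x := by
  simp [hammingNorm]

lemma IsLinearCode.scaledCode {C : Submodule K (ι → K)} {n k d : ℕ} (h : IsLinearCode C n k d)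
    (g : ι → Kˣ) : IsLinearCode (scaledCode g C) n k d := by
  refine ⟨h.1, by rw [finrank_scaledCode, h.2.1], ?_⟩
  convert h.2.2 using 1
  ext w
  constructor
  · rintro ⟨x, hx, hx0, rfl⟩
    refine ⟨_, hx, fun h0 => hx0 (funext fun j => ?_), hammingNorm_units_mul g x⟩
    exact (mul_eq_zero.mp (congrFun h0 j)).resolve_left (g j).ne_zero
  · rintro ⟨x, hx, hx0, rfl⟩
    refine ⟨fun j => ((g j)⁻¹ : Kˣ) * x j, ?_, fun h0 => hx0 (funext fun j => ?_),
      hammingNorm_units_mul (fun j => (g j)⁻¹) x⟩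
    · rw [mem_scaledCode]
      simpa using hx
    · exact (mul_eq_zero.mp (congrFun h0 j)).resolve_left (g j)⁻¹.ne_zero

omit [DecidableEq K] in
lemma IsParityCheck.scaledCode {n r : ℕ} {H : Matrix (Fin r) (Fin n) K}
    {C : Submodule K (Fin n → K)} (h : IsParityCheck H C) (g : Fin n → Kˣ) :
    IsParityCheck (Matrix.of fun i j => H i j * g j) (scaledCode g C) := by
  refine ⟨by rw [finrank_scaledCode, h.1], ?_⟩
  ext x
  rw [mem_scaledCode, ← h.2, mem_nullCode, mem_nullCode]
  have : (Matrix.of fun i j => H i j * (g j : K)).mulVec x = H.mulVec fun j => (g j : K) * x j := by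
    funext i
    simp [Matrix.mulVec, dotProduct, mul_assoc]
  rw [this]

end LinearCodes

/-! ### Quantum tensor product codes -/

section QuantumTensorProduct

variable {K F : Type*} [Field K] [DecidableEq K] [Field F] [DecidableEq F] [Algebra K F]

/-- `IsQ C Q` is a construction of pure quantum codes `Q` from the classical codes `C` that
contain their dual. -/
def IsPureConstruction {ι : Type*} [Fintype ι] [DecidableEq ι] (σ : K →+* K)
    (IsQ : Submodule K (ι → K) → Submodule ℂ ((ι → ZMod 2) → ℂ) → Prop) : Prop :=
  ∀ (C : Submodule K (ι → K)) (r d : ℕ), Module.finrank K C + r = Fintype.card ι →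
    sesquilinearDual σ C ≤ C → (∀ c ∈ C, c ≠ 0 → d ≤ hammingNorm c) →
    ∀ c ∈ C, c ∉ sesquilinearDual σ C → hammingNorm c = d →
    ∃ Q : Submodule ℂ ((ι → ZMod 2) → ℂ), IsQ C Q ∧ 2 * r ≤ Fintype.card ι ∧
      HasParameters Q (Fintype.card ι) (Fintype.card ι - 2 * r) d ∧ IsPureTo Q d

variable {n₁ k₁ d₁ ρ₁ n₂ k₂ d₂ ρ₂ : ℕ}
  {C₁ : Submodule K (Fin n₁ → K)} {C₂ : Submodule F (Fin n₂ → F)}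
  {H₁ : Matrix (Fin ρ₁) (Fin n₁) K} {H₂ : Matrix (Fin ρ₂) (Fin n₂) F}
  {σ : K →+* K}
  {IsQ : Submodule K (Fin n₂ × Fin n₁ → K) →
    Submodule ℂ ((Fin n₂ × Fin n₁ → ZMod 2) → ℂ) → Prop}

/-- The quantum code of a dual containing tensor product code; its minimum distance is that of the
tensor product code. -/
lemma exists_quantumCode_of_tensorProductCode (hQ : IsPureConstruction σ IsQ)
    (b : Module.Basis (Fin ρ₁) K F)
    (hC₁ : IsLinearCode C₁ n₁ k₁ d₁) (hC₂ : IsLinearCode C₂ n₂ k₂ d₂)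
    (hH₁ : IsParityCheck H₁ C₁) (hH₂ : IsParityCheck H₂ C₂)
    (h : sesquilinearDual σ C₁ ≤ C₁ ∨
      sesquilinearDual σ (subfieldSubcode K C₂) ≤ subfieldSubcode K C₂) :
    2 * ρ₁ * ρ₂ ≤ n₁ * n₂ ∧ ∃ (Q : Submodule ℂ ((Fin n₂ × Fin n₁ → ZMod 2) → ℂ)) (d : ℕ),
      IsQ (tensorProductCode b H₁ H₂) Q ∧
      HasParameters Q (n₁ * n₂) (n₁ * n₂ - 2 * ρ₁ * ρ₂) d ∧ IsPureTo Q d ∧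
      min d₁ d₂ ≤ d ∧ d ≤ d₁ ∧
      ∀ c ∈ syndromeCode (psiSyndrome b H₁) C₂, c ≠ 0 → d ≤ hammingNorm c := by
  have hker : LinearMap.ker (psiSyndrome b H₁) = C₁ := (ker_psiSyndrome b H₁).trans hH₁.2
  have hT : tensorProductCode b H₁ H₂ = syndromeCode (psiSyndrome b H₁) C₂ := by
    rw [tensorProductCode_eq_syndromeCode, hH₂.2]
  obtain ⟨d, hmin, hle, hd, c, hc, hcD, hcd⟩ := exists_minDist_syndromeCode (σ := σ)
    (hH₁.psiSyndrome_surjective b) (d₁ := d₁) (d₂ := d₂) (by rw [hker]; exact hC₁.2.2) hC₂.2.2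
    (by rw [hker]; exact h)
  obtain ⟨Q, hQC, hcard, hpar, hpure⟩ := hQ _ (ρ₁ * ρ₂) d
    (hT ▸ finrank_tensorProductCode b hH₁ hH₂)
    (sesquilinearDual_syndromeCode_le (by rw [hker]; exact h)) hd c hc hcD hcd
  rw [Fintype.card_prod, Fintype.card_fin, Fintype.card_fin, mul_comm n₂, ← mul_assoc] at hcard hpar
  exact ⟨hcard, Q, d, hT ▸ hQC, hpar, hpure, hmin, hle, hd⟩

/-- If `d₂ < d₁`, then scaling the coordinates of `C₂` gives a tensor product code of minimum
distance at most `d₂`. -/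
lemma exists_scaledCode_syndromeCode (b : Module.Basis (Fin ρ₁) K F)
    (hC₁ : IsLinearCode C₁ n₁ k₁ d₁) (hC₂ : IsLinearCode C₂ n₂ k₂ d₂)
    (hH₁ : IsParityCheck H₁ C₁) (hlt : d₂ < d₁) :
    ∃ g : Fin n₂ → Fˣ, ∃ c ∈ syndromeCode (psiSyndrome b H₁) (scaledCode g C₂),
      c ≠ 0 ∧ hammingNorm c = d₂ := by
  obtain ⟨w, -, hw0, -⟩ := hC₁.2.2.1
  obtain ⟨i, -⟩ := Function.ne_iff.mp hw0
  obtain ⟨x, hx, hx0, hxd⟩ := hC₂.2.2.1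
  -- Since 1 ≤ d₂ < d₁, the code C₁ has no words of weight one.
  have hβ : psiSyndrome b H₁ (Pi.single i 1) ≠ 0 := by
    intro h0
    have hmem : (Pi.single i 1 : Fin n₁ → K) ∈ C₁ := by
      rw [← hH₁.2, ← ker_psiSyndrome b H₁]
      exact h0
    have h1 := hC₁.2.2.2 ⟨_, hmem, by simp, rfl⟩
    have h2 : hammingNorm (Pi.single i 1 : Fin n₁ → K) ≤ 1 := by
      refine (Finset.card_le_card (t := {i}) fun j hj => ?_).trans (Finset.card_singleton i).le
      by_contra hji
      simp [Pi.single_apply, Finset.mem_singleton.not.mp hji] at hj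
    have h3 := hC₂.pos
    omega
  set β := psiSyndrome b H₁ (Pi.single i 1)
  -- Column i carrying the support indicator u has syndromes β on the support of x; the factors x j
  -- / β turn them into x itself.
  let g : Fin n₂ → Fˣ := fun j => if h : x j = 0 then 1 else Units.mk0 (x j / β) (div_ne_zero h hβ)
  let u : Fin n₂ → K := fun j => if x j = 0 then 0 else 1
  have hu : hammingNorm (columnWord i u) = d₂ := by
    rw [hammingNorm_columnWord, ← hxd]
    simp [hammingNorm, u]
  refine ⟨g, columnWord i u, ?_, fun h0 => ?_, hu⟩
  · rw [mem_syndromeCode, mem_scaledCode]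
    convert hx using 1
    funext j
    rw [map_columnWord]
    by_cases hj : x j = 0
    · simp [u, hj]
    · simp only [u, g, hj, if_false, dif_neg, not_false_eq_true, Units.val_mk0, one_smul]
      exact div_mul_cancel₀ _ hβ
  · rw [h0, hammingNorm_zero] at hu
    exact hC₂.pos.ne hu

/-- For d₁ ≤ d₂ the bounds min d₁ d₂ ≤ d ≤ d₁ already fix d. For d₂ < d₁ the component to modify is
the one on which the dual containment is not assumed, so the assumption survives. -/
theorem exists_quantumTensorProductCodes (hQ : IsPureConstruction σ IsQ)
    (b : Module.Basis (Fin ρ₁) K F)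
    (hC₁ : IsLinearCode C₁ n₁ k₁ d₁) (hC₂ : IsLinearCode C₂ n₂ k₂ d₂)
    (hρ₁ : k₁ + ρ₁ = n₁) (hH₁ : IsParityCheck H₁ C₁) (hH₂ : IsParityCheck H₂ C₂)
    (h : sesquilinearDual σ C₁ ≤ C₁ ∨
      sesquilinearDual σ (psiCode b H₂) ≤ psiCode b H₂) :
    2 * ρ₁ * ρ₂ ≤ n₁ * n₂ ∧
    (∃ (C₁' : Submodule K (Fin n₁ → K)) (C₂' : Submodule F (Fin n₂ → F))
      (H₁' : Matrix (Fin ρ₁) (Fin n₁) K) (H₂' : Matrix (Fin ρ₂) (Fin n₂) F) (d₁' d₂' : ℕ)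
      (Q : Submodule ℂ ((Fin n₂ × Fin n₁ → ZMod 2) → ℂ)),
      IsLinearCode C₁' n₁ k₁ d₁' ∧ IsLinearCode C₂' n₂ k₂ d₂' ∧
      (C₁' = C₁ ∨ C₂' = C₂) ∧ min d₁' d₂' = min d₁ d₂ ∧
      IsParityCheck H₁' C₁' ∧ IsParityCheck H₂' C₂' ∧
      IsQ (tensorProductCode b H₁' H₂') Q ∧
      HasParameters Q (n₁ * n₂) (n₁ * n₂ - 2 * ρ₁ * ρ₂) (min d₁ d₂) ∧
      IsPureTo Q (min d₁ d₂)) ∧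
    (∃ (Q : Submodule ℂ ((Fin n₂ × Fin n₁ → ZMod 2) → ℂ)) (d : ℕ),
      IsQ (tensorProductCode b H₁ H₂) Q ∧
      HasParameters Q (n₁ * n₂) (n₁ * n₂ - 2 * ρ₁ * ρ₂) d ∧
      IsPureTo Q d ∧ min d₁ d₂ ≤ d ∧ (d₁ ≤ d₂ → d = min d₁ d₂)) := by
  rw [psiCode_eq_subfieldSubcode, hH₂.2] at h
  obtain ⟨hle, Q, d, hQC, hpar, hpure, hmin, hd₁, -⟩ :=
    exists_quantumCode_of_tensorProductCode hQ b hC₁ hC₂ hH₁ hH₂ h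
  have hd : d₁ ≤ d₂ → d = min d₁ d₂ := fun h12 => le_antisymm (by rwa [min_eq_left h12]) hmin
  refine ⟨hle, ?_, Q, d, hQC, hpar, hpure, hmin, hd⟩
  rcases le_or_gt d₁ d₂ with h12 | h12
  · exact ⟨C₁, C₂, H₁, H₂, d₁, d₂, Q, hC₁, hC₂, Or.inl rfl, rfl, hH₁, hH₂, hQC, hd h12 ▸ hpar,
      hd h12 ▸ hpure⟩
  rcases h with h | h
  · obtain ⟨g, c, hc, hc0, hcd⟩ := exists_scaledCode_syndromeCode b hC₁ hC₂ hH₁ h12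
    obtain ⟨-, Q', d', hQC', hpar', hpure', hmin', -, hd'⟩ :=
      exists_quantumCode_of_tensorProductCode hQ b hC₁ (hC₂.scaledCode g) hH₁
        (hH₂.scaledCode g) (Or.inl h)
    have heq : d' = min d₁ d₂ :=
      le_antisymm (by rw [min_eq_right h12.le, ← hcd]; exact hd' c hc hc0) hmin'
    exact ⟨C₁, _, H₁, _, d₁, d₂, Q', hC₁, hC₂.scaledCode g, Or.inl rfl, rfl, hH₁,
      hH₂.scaledCode g, hQC', heq ▸ hpar', heq ▸ hpure'⟩
  -- Scaling C₂ could destroy the containment for ψ(C₂). With distance d₂ for C₁', both bounds on d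
  -- become d₂.
  · obtain ⟨C₁', hC₁'⟩ := exists_isLinearCode_of_le hC₁ hC₂.pos h12.le
    obtain ⟨H₁', hH₁'⟩ := exists_isParityCheck (r := ρ₁) C₁' (by rw [hC₁'.2.1, hρ₁])
    obtain ⟨-, Q', d', hQC', hpar', hpure', hmin', hd', -⟩ :=
      exists_quantumCode_of_tensorProductCode hQ b hC₁' hC₂ hH₁' hH₂ (Or.inr h)
    have heq : d' = min d₁ d₂ := by
      rw [min_eq_right h12.le]
      exact le_antisymm hd' (by rwa [min_self] at hmin')
    exact ⟨C₁', C₂, H₁', H₂, d₂, d₂, Q', hC₁', hC₂, Or.inr rfl,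
      by rw [min_self, min_eq_right h12.le], hH₁', hH₂, hQC', heq ▸ hpar', heq ▸ hpure'⟩

omit [DecidableEq K] in
lemma charP_two_of_card_eq_four (hK : Nat.card K = 4) : CharP K 2 := by
  have : Finite K := Nat.finite_of_card_ne_zero (by omega)
  have : Fintype K := Fintype.ofFinite K
  refine CharTwo.of_one_ne_zero_of_two_eq_zero one_ne_zero ?_
  have h : ((Fintype.card K : ℕ) : K) = 0 := Nat.cast_card_eq_zero K
  rw [← Nat.card_eq_fintype_card, hK, show 4 = 2 * 2 from rfl, Nat.cast_mul, mul_self_eq_zero] at h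
  exact_mod_cast h

end QuantumTensorProduct

end QTPC

/-! ### The theorem over the two fields -/

theorem mainTheorem1 {K F : Type*} [Field K] [DecidableEq K] [Field F] [DecidableEq F] [Algebra K F]
    (n₁ k₁ d₁ ρ₁ n₂ k₂ d₂ ρ₂ : ℕ)
    (C₁ : Submodule K (Fin n₁ → K)) (C₂ : Submodule F (Fin n₂ → F))
    (hC₁ : QTPC.IsLinearCode C₁ n₁ k₁ d₁) (hC₂ : QTPC.IsLinearCode C₂ n₂ k₂ d₂)
    (hρ₁ : k₁ + ρ₁ = n₁) (hρ₂ : k₂ + ρ₂ = n₂)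
    -- the basis `1, α, …, α^(ρ₁-1)` of `F = GF(q^ρ₁)` over `K = GF(q)`, with `α` primitive
    (α : F) (hα : IsPrimitiveRoot α (Nat.card F - 1))
    (b : Module.Basis (Fin ρ₁) K F) (hb : ∀ t, b t = α ^ (t : ℕ))
    (H₁ : Matrix (Fin ρ₁) (Fin n₁) K) (H₂ : Matrix (Fin ρ₂) (Fin n₂) F)
    (hH₁ : QTPC.IsParityCheck H₁ C₁) (hH₂ : QTPC.IsParityCheck H₂ C₂) :
    (Nat.card K = 2 →
      (QTPC.euclideanDual C₁ ⊆ C₁ ∨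
        QTPC.euclideanDual (QTPC.psiCode b H₂) ⊆ QTPC.psiCode b H₂) →
      2 * ρ₁ * ρ₂ ≤ n₁ * n₂ ∧
      -- a pure quantum tensor product code with exactly the stated parameters
      (∃ (C₁' : Submodule K (Fin n₁ → K)) (C₂' : Submodule F (Fin n₂ → F))
        (H₁' : Matrix (Fin ρ₁) (Fin n₁) K) (H₂' : Matrix (Fin ρ₂) (Fin n₂) F) (d₁' d₂' : ℕ)
        (Q : Submodule ℂ ((Fin n₂ × Fin n₁ → ZMod 2) → ℂ)),
        QTPC.IsLinearCode C₁' n₁ k₁ d₁' ∧ QTPC.IsLinearCode C₂' n₂ k₂ d₂' ∧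
        (C₁' = C₁ ∨ C₂' = C₂) ∧ min d₁' d₂' = min d₁ d₂ ∧
        QTPC.IsParityCheck H₁' C₁' ∧ QTPC.IsParityCheck H₂' C₂' ∧
        QTPC.IsCSSCode (QTPC.tensorProductCode b H₁' H₂') Q ∧
        QTPC.HasParameters Q (n₁ * n₂) (n₁ * n₂ - 2 * ρ₁ * ρ₂) (min d₁ d₂) ∧
        QTPC.IsPureTo Q (min d₁ d₂)) ∧
      -- the quantum tensor product code of `C₁` and `C₂` themselves
      (∃ (Q : Submodule ℂ ((Fin n₂ × Fin n₁ → ZMod 2) → ℂ)) (d : ℕ),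
        QTPC.IsCSSCode (QTPC.tensorProductCode b H₁ H₂) Q ∧
        QTPC.HasParameters Q (n₁ * n₂) (n₁ * n₂ - 2 * ρ₁ * ρ₂) d ∧
        QTPC.IsPureTo Q d ∧ min d₁ d₂ ≤ d ∧ (d₁ ≤ d₂ → d = min d₁ d₂))) ∧
    (Nat.card K = 4 → ∀ ω : K, ω ^ 2 + ω + 1 = 0 →
      (QTPC.hermitianDual C₁ ⊆ C₁ ∨
        QTPC.hermitianDual (QTPC.psiCode b H₂) ⊆ QTPC.psiCode b H₂) →
      2 * ρ₁ * ρ₂ ≤ n₁ * n₂ ∧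
      (∃ (C₁' : Submodule K (Fin n₁ → K)) (C₂' : Submodule F (Fin n₂ → F))
        (H₁' : Matrix (Fin ρ₁) (Fin n₁) K) (H₂' : Matrix (Fin ρ₂) (Fin n₂) F) (d₁' d₂' : ℕ)
        (Q : Submodule ℂ ((Fin n₂ × Fin n₁ → ZMod 2) → ℂ)),
        QTPC.IsLinearCode C₁' n₁ k₁ d₁' ∧ QTPC.IsLinearCode C₂' n₂ k₂ d₂' ∧
        (C₁' = C₁ ∨ C₂' = C₂) ∧ min d₁' d₂' = min d₁ d₂ ∧
        QTPC.IsParityCheck H₁' C₁' ∧ QTPC.IsParityCheck H₂' C₂' ∧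
        QTPC.IsHermitianCode ω (QTPC.tensorProductCode b H₁' H₂') Q ∧
        QTPC.HasParameters Q (n₁ * n₂) (n₁ * n₂ - 2 * ρ₁ * ρ₂) (min d₁ d₂) ∧
        QTPC.IsPureTo Q (min d₁ d₂)) ∧
      (∃ (Q : Submodule ℂ ((Fin n₂ × Fin n₁ → ZMod 2) → ℂ)) (d : ℕ),
        QTPC.IsHermitianCode ω (QTPC.tensorProductCode b H₁ H₂) Q ∧
        QTPC.HasParameters Q (n₁ * n₂) (n₁ * n₂ - 2 * ρ₁ * ρ₂) d ∧
        QTPC.IsPureTo Q d ∧ min d₁ d₂ ≤ d ∧ (d₁ ≤ d₂ → d = min d₁ d₂))) := by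
  constructor
  · intro hK h
    exact QTPC.exists_quantumTensorProductCodes (σ := RingHom.id K)
      (IsQ := fun C Q => QTPC.IsCSSCode C Q)
      (fun C r d hr hDC hd c hc hcD hcd => QTPC.exists_CSSCode hK C hr hDC hd hc hcD hcd)
      b hC₁ hC₂ hρ₁ hH₁ hH₂ h
  · intro hK ω hω h
    have := QTPC.charP_two_of_card_eq_four hK
    -- The Hermitian dual is the σ-dual for σ the squaring map, by unfolding definitions.
    exact QTPC.exists_quantumTensorProductCodes (σ := frobenius K 2)
      (IsQ := fun C Q => QTPC.IsHermitianCode ω C Q)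
      (fun C r d hr hDC hd c hc hcD hcd => QTPC.exists_hermitianCode hK hω C hr hDC hd hc hcD hcd)
      b hC₁ hC₂ hρ₁ hH₁ hH₂ h
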